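/- Let $n\ge 1$ and let $\mathbb D^n=\{z\in\mathbb C^n: |z_j|<1 \text{ for all } j\}$ be the unit polydisk, with topological boundary $\partial\mathbb D^n$ and Bergman metric $H_z(u,\overline u)=\sum_{j=1}^n \frac{|u_j|^2}{(1-|z_j|^2)^2}$ (normalized so that in dimension one it is $|u|^2/(1-|z|^2)^2$). For a holomorphic $f:\mathbb D^n\to\mathbb C$ put $$Q_f(z)=\sup_{u\in\mathbb C^n\setminus\{0\}}\frac{\left|\sum_{k=1}^n\frac{\partial f}{\partial z_k}(z)u_k\right|}{H_z(u,\overline u)^{1/2}},\qquad \beta_f=\sup_{z\in\mathbb D^n}Q_f(z),$$ and let the Bloch space $\mathcal B(\mathbb D^n)$ be the space of holomorphic $f$ with $\beta_f<\infty$, with the norm $\|f\|_{\mathcal B}=|f(0)|+\beta_f$. Let $\psi:\mathbb D^n\to\mathbb C$ and $\varphi:\mathbb D^n\to\mathbb D^n$ be holomorphic, and let $W_{\psi,\varphi}f=\psi\,(f\circ\varphi)$. For $z\in\mathbb D^n$ let $$\omega(z)=\sup\{|f(z)|: f\in\mathcal B(\mathbb D^n),\ f(0)=0,\ \|f\|_{\mathcal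 B}\le 1\},\qquad T_\varphi(z)=\sup\{Q_{f\circ\varphi}(z): f\in\mathcal B(\mathbb D^n),\ \beta_f\le 1\},$$ $$\sigma_{\psi,\varphi}=\sup_{z\in\mathbb D^n}\omega(\varphi(z))\,Q_\psi(z),\qquad \tau_{\psi,\varphi}=\sup_{z\in\mathbb D^n}|\psi(z)|\,T_\varphi(z).$$ Then $W_{\psi,\varphi}$ is a bounded operator on $\mathcal B(\mathbb D^n)$ if and only if $\psi\in\mathcal B(\mathbb D^n)$ and $\sigma_{\psi,\varphi}$ and $\tau_{\psi,\varphi}$ are finite. Furthermore, if $W_{\psi,\varphi}$ is bounded on $\mathcal B(\mathbb D^n)$, then it is compact on $\mathcal B(\mathbb D^n)$ if and only if $$\lim_{\varphi(z)\to\partial\mathbb D^n}\omega(\varphi(z))\,Q_\psi(z)=0\quad\text{and}\quad \lim_{\varphi(z)\to\partial\mathbb D^n}|\psi(z)|\,T_\varphi(z)=0,$$ where $\lim_{\varphi(z)\to\partial\mathbb D^n}F(z)=0$ means: for every $\varepsilon>0$ there is $\delta>0$ such that $|F(z)|<\varepsilon$ for all $z\in\mathbb D^n$ with $\operatorname{dist}(\varphi(z),\partial\mathbb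 D^n)<\delta$ (in particular it holds if no $z$ has $\varphi(z)$ close to $\partial\mathbb D^n$). -/

import Mathlib

open Filter Topology
open scoped ENNReal

noncomputable section

/-- The open unit polydisk `𝔻ⁿ` in `ℂⁿ`. -/
def polydisk (n : ℕ) : Set (Fin n → ℂ) := {z | ∀ j, ‖z j‖ < 1}

theorem isOpen_polydisk (n : ℕ) : IsOpen (polydisk n) := by
  have h : polydisk n = ⋂ j : Fin n, {z : Fin n → ℂ | ‖z j‖ < 1} := by
    ext z
    simp [polydisk]
  rw [h]
  exact isOpen_iInter_of_finite fun j => isOpen_lt (by fun_prop) continuous_const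

theorem convex_polydisk (n : ℕ) : Convex ℝ (polydisk n) := by
  have h : polydisk n = Set.univ.pi fun _ : Fin n => Metric.ball (0 : ℂ) 1 := by
    ext z
    simp [polydisk]
  rw [h]
  exact convex_pi fun j _ => convex_ball 0 1

/-- The origin, as a point of the polydisk. -/
def polydiskZero (n : ℕ) : polydisk n := ⟨0, fun j => by simp⟩

/-- Extension by zero of a map on the polydisk to all of `ℂⁿ`. It only serves to speak of
derivatives at points of the (open) polydisk; these do not depend on the extension. -/
def zeroExt {n : ℕ} {F : Type*} [Zero F] (f : polydisk n → F) : (Fin n → ℂ) → F :=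
  Function.extend Subtype.val f 0

/-- A map on the polydisk is holomorphic if it is complex differentiable at each point. -/
def IsHol {n : ℕ} {F : Type*} [NormedAddCommGroup F] [NormedSpace ℂ F]
    (f : polydisk n → F) : Prop :=
  DifferentiableOn ℂ (zeroExt f) (polydisk n)

/-- `(∇f)(z)u = ∑ₖ (∂f/∂zₖ)(z) uₖ`, the complex derivative of `f` at `z` applied to `u`. -/
def gradApply {n : ℕ} (f : polydisk n → ℂ) (z : polydisk n) (u : Fin n → ℂ) : ℂ :=
  fderiv ℂ (zeroExt f) z u

/-- The Bergman metric `H_z(u, ū) = ∑ⱼ |uⱼ|² / (1 - |zⱼ|²)²` of the polydisk (normalized so that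
on the unit disk it is `|u|² / (1 - |z|²)²`). -/
def bergmanH {n : ℕ} (z : polydisk n) (u : Fin n → ℂ) : ℝ :=
  ∑ j, ‖u j‖ ^ 2 / (1 - ‖z.1 j‖ ^ 2) ^ 2

/-- `Q_f(z) = sup_{u ≠ 0} |(∇f)(z)u| / H_z(u, ū)^{1/2}`. -/
def blochQ {n : ℕ} (f : polydisk n → ℂ) (z : polydisk n) : ℝ≥0∞ :=
  ⨆ (u : Fin n → ℂ) (_ : u ≠ 0), ENNReal.ofReal (‖gradApply f z u‖ / √(bergmanH z u))

/-- `β_f = sup_z Q_f(z)`. -/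
def blochBeta {n : ℕ} (f : polydisk n → ℂ) : ℝ≥0∞ := ⨆ z, blochQ f z

section Helpers

variable {n : ℕ}

theorem zeroExt_coe {F : Type*} [Zero F] (f : polydisk n → F) (z : polydisk n) :
    zeroExt f z = f z :=
  Subtype.val_injective.extend_apply f 0 z

theorem zeroExt_zero {F : Type*} [Zero F] : zeroExt (0 : polydisk n → F) = 0 := by
  classical
  funext z
  by_cases hz : z ∈ polydisk n
  · exact zeroExt_coe (0 : polydisk n → F) ⟨z, hz⟩
  · exact Function.extend_apply' _ _ _ (by rintro ⟨w, rfl⟩; exact hz w.2)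

theorem zeroExt_add (f g : polydisk n → ℂ) : zeroExt (f + g) = zeroExt f + zeroExt g := by
  simpa [zeroExt] using Function.extend_add (Subtype.val : polydisk n → _) f g 0 0

theorem zeroExt_smul (c : ℂ) (f : polydisk n → ℂ) : zeroExt (c • f) = c • zeroExt f := by
  simpa [zeroExt] using Function.extend_smul c (Subtype.val : polydisk n → _) f 0

theorem IsHol.differentiableAt {f : polydisk n → ℂ} (hf : IsHol f) (z : polydisk n) :
    DifferentiableAt ℂ (zeroExt f) z :=
  DifferentiableOn.differentiableAt hf ((isOpen_polydisk n).mem_nhds z.2)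

theorem isHol_zero : IsHol (0 : polydisk n → ℂ) := by
  rw [IsHol, zeroExt_zero]
  exact differentiableOn_const 0

theorem IsHol.add {f g : polydisk n → ℂ} (hf : IsHol f) (hg : IsHol g) : IsHol (f + g) := by
  rw [IsHol, zeroExt_add]
  exact DifferentiableOn.add hf hg

theorem IsHol.smul {f : polydisk n → ℂ} (hf : IsHol f) (c : ℂ) : IsHol (c • f) := by
  rw [IsHol, zeroExt_smul]
  exact DifferentiableOn.const_smul hf c

theorem gradApply_add {f g : polydisk n → ℂ} (hf : IsHol f) (hg : IsHol g) (z : polydisk n)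
    (u : Fin n → ℂ) : gradApply (f + g) z u = gradApply f z u + gradApply g z u := by
  rw [gradApply, zeroExt_add, fderiv_add (hf.differentiableAt z) (hg.differentiableAt z)]
  rfl

theorem gradApply_smul {f : polydisk n → ℂ} (hf : IsHol f) (c : ℂ) (z : polydisk n)
    (u : Fin n → ℂ) : gradApply (c • f) z u = c * gradApply f z u := by
  rw [gradApply, zeroExt_smul, fderiv_const_smul (hf.differentiableAt z)]
  rfl

theorem bergmanH_pos (z : polydisk n) {u : Fin n → ℂ} (hu : u ≠ 0) : 0 < bergmanH z u := by
  have hz : ∀ j, 0 < 1 - ‖z.1 j‖ ^ 2 := fun j => by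
    have := z.2 j
    have := norm_nonneg (z.1 j)
    nlinarith
  obtain ⟨j, hj⟩ := Function.ne_iff.1 hu
  refine Finset.sum_pos' (fun i _ => by positivity) ⟨j, Finset.mem_univ j, ?_⟩
  have h1 : 0 < ‖u j‖ := norm_pos_iff.2 hj
  have h2 := hz j
  positivity

theorem blochBeta_zero : blochBeta (0 : polydisk n → ℂ) = 0 := by
  simp [blochBeta, blochQ, gradApply, zeroExt_zero]

theorem blochBeta_add_le {f g : polydisk n → ℂ} (hf : IsHol f) (hg : IsHol g) :
    blochBeta (f + g) ≤ blochBeta f + blochBeta g := by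
  refine iSup_le fun z => iSup₂_le fun u hu => ?_
  have key : ∀ h : polydisk n → ℂ,
      ENNReal.ofReal (‖gradApply h z u‖ / √(bergmanH z u)) ≤ blochBeta h := fun h =>
    le_trans (le_iSup₂ (f := fun (u : Fin n → ℂ) (_ : u ≠ 0) =>
      ENNReal.ofReal (‖gradApply h z u‖ / √(bergmanH z u))) u hu) (le_iSup (blochQ h) z)
  refine le_trans ?_ (add_le_add (key f) (key g))
  rw [← ENNReal.ofReal_add (by positivity) (by positivity), ← add_div, gradApply_add hf hg]
  exact ENNReal.ofReal_le_ofReal (by gcongr; exact norm_add_le _ _)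

theorem blochBeta_smul {f : polydisk n → ℂ} (hf : IsHol f) (c : ℂ) :
    blochBeta (c • f) = ENNReal.ofReal ‖c‖ * blochBeta f := by
  simp only [blochBeta, blochQ, ENNReal.mul_iSup]
  refine iSup_congr fun z => iSup_congr fun u => iSup_congr fun _ => ?_
  rw [← ENNReal.ofReal_mul (norm_nonneg c), gradApply_smul hf, norm_mul, mul_div_assoc]

theorem eq_zero_of_blochBeta_eq_zero {f : polydisk n → ℂ} (hf : IsHol f)
    (h0 : f (polydiskZero n) = 0) (hβ : blochBeta f = 0) : f = 0 := by
  have hd : ∀ z ∈ polydisk n, fderiv ℂ (zeroExt f) z = 0 := by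
    intro z hz
    ext1 u
    by_cases hu : u = 0
    · simp [hu]
    · have h1 := (iSup_eq_bot.1 hβ) ⟨z, hz⟩
      have h2 : ENNReal.ofReal (‖gradApply f ⟨z, hz⟩ u‖ / √(bergmanH ⟨z, hz⟩ u)) = 0 :=
        iSup_eq_bot.1 (iSup_eq_bot.1 h1 u) hu
      have h3 : 0 < √(bergmanH (⟨z, hz⟩ : polydisk n) u) := Real.sqrt_pos.2 (bergmanH_pos _ hu)
      rw [ENNReal.ofReal_eq_zero, div_le_iff₀ h3, zero_mul] at h2
      exact norm_eq_zero.1 (le_antisymm h2 (norm_nonneg _))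
  funext z
  have h := (isOpen_polydisk n).is_const_of_fderiv_eq_zero
    (convex_polydisk n).isPreconnected hf hd z.2 (polydiskZero n).2
  rw [zeroExt_coe, zeroExt_coe, h0] at h
  exact h

end Helpers

/-- The Bloch functions on the polydisk: holomorphic `f` with `β_f < ∞`. -/
def blochSubmodule (n : ℕ) : Submodule ℂ (polydisk n → ℂ) where
  carrier := {f | IsHol f ∧ blochBeta f < ⊤}
  zero_mem' := ⟨isHol_zero, by simp [blochBeta_zero]⟩
  add_mem' := fun hf hg => ⟨hf.1.add hg.1,
    (blochBeta_add_le hf.1 hg.1).trans_lt (ENNReal.add_lt_top.2 ⟨hf.2, hg.2⟩)⟩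
  smul_mem' := fun c f hf => ⟨hf.1.smul c, by
    rw [blochBeta_smul hf.1]
    exact ENNReal.mul_lt_top ENNReal.ofReal_lt_top hf.2⟩

/-- The Bloch space `𝓑(𝔻ⁿ)`. It is a type of its own, so that its topology is the one of the
Bloch norm and not the one of pointwise convergence. -/
def Bloch (n : ℕ) : Type := blochSubmodule n

namespace Bloch

variable {n : ℕ}

instance : AddCommGroup (Bloch n) := inferInstanceAs (AddCommGroup (blochSubmodule n))

instance : Module ℂ (Bloch n) := inferInstanceAs (Module ℂ (blochSubmodule n))

/-- The function underlying an element of the Bloch space. -/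
def fn (f : Bloch n) : polydisk n → ℂ := Subtype.val f

/-- The Bloch norm `‖f‖ = |f(0)| + β_f`. -/
instance : Norm (Bloch n) := ⟨fun f => ‖f.fn (polydiskZero n)‖ + (blochBeta f.fn).toReal⟩

theorem norm_def (f : Bloch n) :
    ‖f‖ = ‖f.fn (polydiskZero n)‖ + (blochBeta f.fn).toReal := rfl

theorem isHol (f : Bloch n) : IsHol f.fn := f.2.1

theorem beta_lt_top (f : Bloch n) : blochBeta f.fn < ⊤ := f.2.2

theorem normCore : NormedSpace.Core ℂ (Bloch n) where
  norm_nonneg f := by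
    rw [norm_def]
    positivity
  norm_smul c f := by
    have h : (c • f).fn = c • f.fn := rfl
    rw [norm_def, norm_def, h, blochBeta_smul f.isHol, ENNReal.toReal_mul,
      ENNReal.toReal_ofReal (norm_nonneg c), Pi.smul_apply, norm_smul, mul_add]
  norm_triangle f g := by
    have h : (f + g).fn = f.fn + g.fn := rfl
    have h1 := ENNReal.toReal_mono
      (ENNReal.add_lt_top.2 ⟨f.beta_lt_top, g.beta_lt_top⟩).ne (blochBeta_add_le f.isHol g.isHol)
    rw [ENNReal.toReal_add f.beta_lt_top.ne g.beta_lt_top.ne] at h1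
    have h2 := norm_add_le (f.fn (polydiskZero n)) (g.fn (polydiskZero n))
    rw [norm_def, norm_def, norm_def, h, Pi.add_apply]
    linarith
  norm_eq_zero_iff f := by
    constructor
    · intro h
      rw [norm_def, add_eq_zero_iff_of_nonneg (norm_nonneg _) ENNReal.toReal_nonneg] at h
      have hβ : blochBeta f.fn = 0 :=
        (ENNReal.toReal_eq_zero_iff _).1 h.2 |>.resolve_right f.beta_lt_top.ne
      exact Subtype.ext (eq_zero_of_blochBeta_eq_zero f.isHol (norm_eq_zero.1 h.1) hβ)
    · rintro rfl
      have h : (0 : Bloch n).fn = 0 := rfl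
      rw [norm_def, h, blochBeta_zero]
      simp

instance : NormedAddCommGroup (Bloch n) := NormedAddCommGroup.ofCore normCore

instance : NormedSpace ℂ (Bloch n) := NormedSpace.ofCore normCore

end Bloch

/-- `ω(z) = sup {|f(z)| : f ∈ 𝓑(𝔻ⁿ), f(0) = 0, ‖f‖ ≤ 1}`. -/
def blochOmega {n : ℕ} (z : polydisk n) : ℝ≥0∞ :=
  ⨆ (f : Bloch n) (_ : f.fn (polydiskZero n) = 0) (_ : ‖f‖ ≤ 1), ENNReal.ofReal ‖f.fn z‖

/-- `T_φ(z) = sup {Q_{f ∘ φ}(z) : f ∈ 𝓑(𝔻ⁿ), β_f ≤ 1}`. -/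
def blochT {n : ℕ} (φ : polydisk n → polydisk n) (z : polydisk n) : ℝ≥0∞ :=
  ⨆ (f : Bloch n) (_ : blochBeta f.fn ≤ 1), blochQ (f.fn ∘ φ) z

/-- `σ_{ψ,φ} = sup_z ω(φ(z)) Q_ψ(z)`. -/
def wcoSigma {n : ℕ} (ψ : polydisk n → ℂ) (φ : polydisk n → polydisk n) : ℝ≥0∞ :=
  ⨆ z, blochOmega (φ z) * blochQ ψ z

/-- `τ_{ψ,φ} = sup_z |ψ(z)| T_φ(z)`. -/
def wcoTau {n : ℕ} (ψ : polydisk n → ℂ) (φ : polydisk n → polydisk n) : ℝ≥0∞ :=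
  ⨆ z, ENNReal.ofReal ‖ψ z‖ * blochT φ z

/-- The bounded operator `T` on the Bloch space is the weighted composition operator
`W_{ψ,φ} f = ψ (f ∘ φ)`. -/
def IsWCO {n : ℕ} (ψ : polydisk n → ℂ) (φ : polydisk n → polydisk n)
    (T : Bloch n →L[ℂ] Bloch n) : Prop :=
  ∀ f z, (T f).fn z = ψ z * f.fn (φ z)

/-- The filter `φ(z) → ∂𝔻ⁿ` on the polydisk: its basic sets are the `z` for which `φ(z)` lies in
a given neighborhood of the topological boundary `∂𝔻ⁿ` (a compact set). -/
def toBoundary {n : ℕ} (φ : polydisk n → polydisk n) : Filter (polydisk n) :=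
  comap (fun z => (φ z : Fin n → ℂ)) (𝓝ˢ (frontier (polydisk n)))

end

/-! Everything rests on the product rule `∇(ψ · f∘φ) = f(φ) ∇ψ + ψ ∇(f∘φ)`. Together with `|f(w)| ≤
|f(0)| + ω(w)‖f‖` and `Q_{f∘φ} ≤ T_φ ‖f‖` it bounds `Q` of the image pointwise, so finite `σ` and
`τ` suffice for boundedness.

Conversely, applying the operator to `1` gives `ψ ∈ 𝓑`. For `τ` one tests on functions that vanish
at `a = φ(z)` and have gradient of size `|u_j| / (1 - |a_j|²)` there
(`exists_bloch_extremal_deriv`): the `∇ψ` term disappears, and summing over `j` dominates the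
Bergman length, so `|ψ(z)| T_φ(z) ≤ ∑ ‖T F_j‖`. Then `σ` follows by solving the product rule for
`f(φ) ∇ψ`.

If `T` is compact, it sends bounded pointwise null families to norm null ones. The test functions
above tend to zero pointwise as `a` approaches the boundary, which gives the limit for `τ`. For `σ`
one uses squared logarithms of size `Λ = -log(1 - ‖a‖²)` at `a` (`exists_bloch_extremal_value`),
since `ω(a) ≤ 2nΛ`.

If both limits vanish, a normal-families argument (`Bloch.exists_tendsto_fn`) makes the unit ball
compact for pointwise convergence, and `T` turns bounded pointwise convergence into norm
convergence. Near the boundary the limits do this. Where `‖φ(z)‖ ≤ r`, Cauchy's estimate makes the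
gradients of `f` small, and the extremal functions together with boundedness of `T` control `|ψ|
Q_{f∘φ}`. -/

noncomputable section

/-! ### Bergman length, product and chain rules, growth and gradient estimates. -/

section Basic

variable {n : ℕ}

theorem mem_polydisk_iff_norm_lt {z : Fin n → ℂ} : z ∈ polydisk n ↔ ‖z‖ < 1 :=
  (pi_norm_lt_iff one_pos).symm

theorem polydisk_eq_ball (n : ℕ) : polydisk n = Metric.ball 0 1 := by
  ext z
  rw [mem_polydisk_iff_norm_lt, mem_ball_zero_iff]

theorem polydisk_mem_nhds (z : polydisk n) : polydisk n ∈ 𝓝 (z : Fin n → ℂ) :=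
  (isOpen_polydisk n).mem_nhds z.2

theorem one_sub_norm_pos (z : polydisk n) (j : Fin n) : 0 < 1 - ‖z.1 j‖ := sub_pos.2 (z.2 j)

theorem one_sub_norm_sq_pos (z : polydisk n) (j : Fin n) : 0 < 1 - ‖z.1 j‖ ^ 2 := by
  have := z.2 j
  have := norm_nonneg (z.1 j)
  nlinarith

theorem zeroExt_restrict_eventuallyEq {F : Type*} [Zero F] (G : (Fin n → ℂ) → F)
    (z : polydisk n) : zeroExt (fun w : polydisk n => G w) =ᶠ[𝓝 (z : Fin n → ℂ)] G := by
  filter_upwards [polydisk_mem_nhds z] with w hw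
  exact zeroExt_coe (fun w : polydisk n => G w) ⟨w, hw⟩

theorem isHol_restrict {F : Type*} [NormedAddCommGroup F] [NormedSpace ℂ F]
    {G : (Fin n → ℂ) → F} (hG : ∀ z ∈ polydisk n, DifferentiableAt ℂ G z) :
    IsHol (fun w : polydisk n => G w) := fun z hz =>
  ((hG z hz).congr_of_eventuallyEq
    (zeroExt_restrict_eventuallyEq G ⟨z, hz⟩)).differentiableWithinAt

theorem gradApply_restrict (G : (Fin n → ℂ) → ℂ) (z : polydisk n) (u : Fin n → ℂ) :
    gradApply (fun w : polydisk n => G w) z u = fderiv ℂ G z u := by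
  rw [gradApply, (zeroExt_restrict_eventuallyEq G z).fderiv_eq]

theorem isHol_const (c : ℂ) : IsHol (fun _ : polydisk n => c) :=
  isHol_restrict (G := fun _ => c) fun _ _ => differentiableAt_const _

theorem gradApply_const (c : ℂ) (z : polydisk n) (u : Fin n → ℂ) :
    gradApply (fun _ => c) z u = 0 := by
  rw [gradApply_restrict (fun _ => c)]
  simp

theorem IsHol.hasFDerivAt {F : Type*} [NormedAddCommGroup F] [NormedSpace ℂ F]
    {f : polydisk n → F} (hf : IsHol f) (z : polydisk n) :
    HasFDerivAt (zeroExt f) (fderiv ℂ (zeroExt f) z) z :=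
  (DifferentiableOn.differentiableAt hf (polydisk_mem_nhds z)).hasFDerivAt

/-- The Bergman length is the ℓ² norm of the weighted coordinates, so it lies between their maximum
and their sum. This reduces estimates to single coordinates. -/
theorem norm_div_le_sqrt_bergmanH (z : polydisk n) (u : Fin n → ℂ) (j : Fin n) :
    ‖u j‖ / (1 - ‖z.1 j‖ ^ 2) ≤ √(bergmanH z u) := by
  refine Real.le_sqrt_of_sq_le ?_
  rw [div_pow]
  exact Finset.single_le_sum (f := fun j => ‖u j‖ ^ 2 / (1 - ‖z.1 j‖ ^ 2) ^ 2)
    (fun _ _ => by positivity) (Finset.mem_univ j)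

theorem sqrt_bergmanH_le_sum (z : polydisk n) (u : Fin n → ℂ) :
    √(bergmanH z u) ≤ ∑ j, ‖u j‖ / (1 - ‖z.1 j‖ ^ 2) := by
  have h : ∀ j ∈ Finset.univ, 0 ≤ ‖u j‖ / (1 - ‖z.1 j‖ ^ 2) := fun j _ =>
    div_nonneg (norm_nonneg _) (one_sub_norm_sq_pos z j).le
  refine Real.sqrt_le_iff.2 ⟨Finset.sum_nonneg h, ?_⟩
  simpa only [bergmanH, ← div_pow] using Finset.sum_sq_le_sq_sum_of_nonneg h

theorem blochQ_le_ofReal_iff {f : polydisk n → ℂ} {z : polydisk n} {C : ℝ} (hC : 0 ≤ C) :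
    blochQ f z ≤ ENNReal.ofReal C ↔ ∀ u, ‖gradApply f z u‖ ≤ C * √(bergmanH z u) := by
  simp only [blochQ, iSup_le_iff]
  refine forall_congr' fun u => ?_
  by_cases hu : u = 0
  · simp [hu, gradApply]
    positivity
  · rw [ENNReal.ofReal_le_ofReal_iff hC, div_le_iff₀ (Real.sqrt_pos.2 (bergmanH_pos z hu))]
    exact ⟨fun h => h hu, fun h _ => h⟩

theorem blochBeta_le_ofReal_iff {f : polydisk n → ℂ} {C : ℝ} (hC : 0 ≤ C) :
    blochBeta f ≤ ENNReal.ofReal C ↔ ∀ z u, ‖gradApply f z u‖ ≤ C * √(bergmanH z u) := by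
  simp only [blochBeta, iSup_le_iff, blochQ_le_ofReal_iff hC]

theorem blochQ_le_blochBeta (f : polydisk n → ℂ) (z : polydisk n) : blochQ f z ≤ blochBeta f :=
  le_iSup (blochQ f) z

theorem IsHol.hasFDerivAt_mul_comp {p g : polydisk n → ℂ} {φ : polydisk n → polydisk n}
    (hp : IsHol p) (hg : IsHol g) (hφ : IsHol (fun z => (φ z : Fin n → ℂ))) (z : polydisk n) :
    HasFDerivAt (zeroExt fun z => p z * g (φ z))
      (p z • (fderiv ℂ (zeroExt g) (φ z)).comp
        (fderiv ℂ (zeroExt fun z => (φ z : Fin n → ℂ)) z) +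
        g (φ z) • fderiv ℂ (zeroExt p) z) z := by
  have hφz : zeroExt (fun z => (φ z : Fin n → ℂ)) z = φ z := zeroExt_coe _ z
  have h2 := hg.hasFDerivAt (φ z)
  -- The chain rule needs the base point in the form of the extended map evaluated at `z`.
  rw [← hφz] at h2
  have h := (hp.hasFDerivAt z).mul (h2.comp (z : Fin n → ℂ) (hφ.hasFDerivAt z))
  simp only [Function.comp_apply, hφz, zeroExt_coe] at h
  refine h.congr_of_eventuallyEq ?_
  filter_upwards [polydisk_mem_nhds z] with w hw
  have h0 := zeroExt_coe (fun z => p z * g (φ z)) ⟨w, hw⟩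
  have h1 := zeroExt_coe p ⟨w, hw⟩
  have h2 := zeroExt_coe (fun z => (φ z : Fin n → ℂ)) ⟨w, hw⟩
  dsimp only at h0 h1 h2
  rw [Pi.mul_apply, Function.comp_apply, h0, h1, h2, zeroExt_coe]

theorem IsHol.mul_comp {p g : polydisk n → ℂ} {φ : polydisk n → polydisk n} (hp : IsHol p)
    (hg : IsHol g) (hφ : IsHol (fun z => (φ z : Fin n → ℂ))) :
    IsHol (fun z => p z * g (φ z)) := fun w hw =>
  (hp.hasFDerivAt_mul_comp hg hφ ⟨w, hw⟩).differentiableAt.differentiableWithinAt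

/-- The derivative of a product `p · (g ∘ φ)`. -/
theorem gradApply_mul_comp {p g : polydisk n → ℂ} {φ : polydisk n → polydisk n} (hp : IsHol p)
    (hg : IsHol g) (hφ : IsHol (fun z => (φ z : Fin n → ℂ))) (z : polydisk n) (u : Fin n → ℂ) :
    gradApply (fun z => p z * g (φ z)) z u = g (φ z) * gradApply p z u +
      p z * gradApply g (φ z) (fderiv ℂ (zeroExt fun z => (φ z : Fin n → ℂ)) z u) := by
  rw [gradApply, (hp.hasFDerivAt_mul_comp hg hφ z).fderiv, add_comm]
  rfl

theorem gradApply_comp {g : polydisk n → ℂ} {φ : polydisk n → polydisk n}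
    (hg : IsHol g) (hφ : IsHol (fun z => (φ z : Fin n → ℂ))) (z : polydisk n) (u : Fin n → ℂ) :
    gradApply (g ∘ φ) z u =
      gradApply g (φ z) (fderiv ℂ (zeroExt fun z => (φ z : Fin n → ℂ)) z u) := by
  simpa [gradApply_const, Function.comp_def] using gradApply_mul_comp (isHol_const 1) hg hφ z u

theorem IsHol.comp {g : polydisk n → ℂ} {φ : polydisk n → polydisk n} (hg : IsHol g)
    (hφ : IsHol (fun z => (φ z : Fin n → ℂ))) : IsHol (g ∘ φ) := by
  simpa [Function.comp_def] using (isHol_const 1).mul_comp hg hφ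

namespace Bloch

theorem beta_toReal_le_norm (f : Bloch n) : (blochBeta f.fn).toReal ≤ ‖f‖ := by
  rw [norm_def]
  exact le_add_of_nonneg_left (norm_nonneg _)

theorem beta_le_ofReal_norm (f : Bloch n) : blochBeta f.fn ≤ ENNReal.ofReal ‖f‖ := by
  rw [← ENNReal.ofReal_toReal f.beta_lt_top.ne]
  exact ENNReal.ofReal_le_ofReal f.beta_toReal_le_norm

theorem norm_fn_zero_le (f : Bloch n) : ‖f.fn (polydiskZero n)‖ ≤ ‖f‖ := by
  rw [norm_def]
  exact le_add_of_nonneg_right ENNReal.toReal_nonneg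

theorem norm_gradApply_le (f : Bloch n) (z : polydisk n) (u : Fin n → ℂ) :
    ‖gradApply f.fn z u‖ ≤ ‖f‖ * √(bergmanH z u) :=
  (blochBeta_le_ofReal_iff (norm_nonneg f)).1 f.beta_le_ofReal_norm z u

theorem sub_fn (f g : Bloch n) (z : polydisk n) : (f - g).fn z = f.fn z - g.fn z := rfl

theorem smul_fn (c : ℂ) (f : Bloch n) (z : polydisk n) : (c • f).fn z = c * f.fn z := rfl

theorem fn_injective : Function.Injective (fn : Bloch n → polydisk n → ℂ) :=
  Subtype.val_injective

/-- The Bloch function given by a holomorphic function with controlled derivative. -/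
def ofBound (f : polydisk n → ℂ) (hf : IsHol f) (C : ℝ) (hC : 0 ≤ C)
    (h : ∀ z u, ‖gradApply f z u‖ ≤ C * √(bergmanH z u)) : Bloch n :=
  ⟨f, hf, ((blochBeta_le_ofReal_iff hC).2 h).trans_lt ENNReal.ofReal_lt_top⟩

theorem norm_le {f : Bloch n} {A C : ℝ} (hC : 0 ≤ C) (h0 : ‖f.fn (polydiskZero n)‖ ≤ A)
    (h : ∀ z u, ‖gradApply f.fn z u‖ ≤ C * √(bergmanH z u)) : ‖f‖ ≤ A + C := by
  rw [norm_def]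
  refine add_le_add h0 (ENNReal.toReal_le_of_le_ofReal hC ?_)
  exact (blochBeta_le_ofReal_iff hC).2 h

/-- The constant Bloch function. -/
def const (n : ℕ) (c : ℂ) : Bloch n :=
  ofBound (fun _ => c) (isHol_const c) 0 le_rfl fun z u => by simp [gradApply_const]

/-- Growth of Bloch functions. -/
theorem norm_fn_sub_fn_zero_le (f : Bloch n) (z : polydisk n) :
    ‖f.fn z - f.fn (polydiskZero n)‖ ≤ ‖f‖ * ∑ j, -Real.log (1 - ‖z.1 j‖) := by
  have hmem : ∀ t ∈ Set.Icc (0 : ℝ) 1, (t • z.1) ∈ polydisk n := fun t ht j => by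
    have h1 := z.2 j
    have h2 := norm_nonneg (z.1 j)
    rw [Pi.smul_apply, norm_smul, Real.norm_of_nonneg ht.1]
    nlinarith [ht.1, ht.2]
  have hpos : ∀ t ∈ Set.Icc (0 : ℝ) 1, ∀ j, 0 < 1 - t * ‖z.1 j‖ := fun t ht j => by
    have h := hmem t ht j
    rw [Pi.smul_apply, norm_smul, Real.norm_of_nonneg ht.1] at h
    linarith
  have hd : ∀ t ∈ Set.Icc (0 : ℝ) 1, HasDerivAt
      (fun t : ℝ => zeroExt f.fn (t • z.1) - f.fn (polydiskZero n))
      (fderiv ℂ (zeroExt f.fn) (t • z.1) z.1) t := fun t ht => by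
    have h1 := (f.isHol.hasFDerivAt ⟨t • z.1, hmem t ht⟩).restrictScalars ℝ
    have h2 : HasDerivAt (fun t : ℝ => t • z.1) z.1 t := by
      simpa using (hasDerivAt_id t).smul_const z.1
    exact (h1.comp_hasDerivAt t h2).sub_const _
  have hB : ∀ t ∈ Set.Icc (0 : ℝ) 1, HasDerivAt
      (fun t : ℝ => ‖f‖ * ∑ j, -Real.log (1 - t * ‖z.1 j‖))
      (‖f‖ * ∑ j, ‖z.1 j‖ / (1 - t * ‖z.1 j‖)) t := fun t ht => by
    refine HasDerivAt.const_mul _ (HasDerivAt.fun_sum fun j _ => ?_)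
    have h := ((((hasDerivAt_id t).mul_const ‖z.1 j‖).const_sub 1).log (hpos t ht j).ne').neg
    convert h using 1
    · rfl
    · simp [neg_div]
  -- Comparison along the segment `t ↦ tz`: since `1 - (t|z_j|)² ≥ 1 - t|z_j|`, the derivative is
  -- dominated by one whose primitive is exactly the logarithmic sum.
  have key := image_norm_le_of_norm_deriv_right_le_deriv_boundary'
    (a := 0) (b := 1) (f := fun t : ℝ => zeroExt f.fn (t • z.1) - f.fn (polydiskZero n))
    (f' := fun t => fderiv ℂ (zeroExt f.fn) (t • z.1) z.1)
    (B := fun t : ℝ => ‖f‖ * ∑ j, -Real.log (1 - t * ‖z.1 j‖))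
    (B' := fun t => ‖f‖ * ∑ j, ‖z.1 j‖ / (1 - t * ‖z.1 j‖))
    (fun t ht => (hd t ht).continuousAt.continuousWithinAt)
    (fun t ht => (hd t (Set.Ico_subset_Icc_self ht)).hasDerivWithinAt)
    (by
      have : zeroExt f.fn 0 = f.fn (polydiskZero n) := zeroExt_coe f.fn (polydiskZero n)
      simp [this])
    (fun t ht => (hB t ht).continuousAt.continuousWithinAt)
    (fun t ht => (hB t (Set.Ico_subset_Icc_self ht)).hasDerivWithinAt)
    (fun t ht => by
      have ht' := Set.Ico_subset_Icc_self ht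
      refine (f.norm_gradApply_le ⟨t • z.1, hmem t ht'⟩ z.1).trans ?_
      gcongr
      refine (sqrt_bergmanH_le_sum _ _).trans (Finset.sum_le_sum fun j _ => ?_)
      have h1 := hpos t ht' j
      have h2 : 0 ≤ t * ‖z.1 j‖ := mul_nonneg ht.1 (norm_nonneg _)
      have h3 : ‖(t • z.1) j‖ = t * ‖z.1 j‖ := by
        rw [Pi.smul_apply, norm_smul, Real.norm_of_nonneg ht.1]
      dsimp only
      rw [h3]
      gcongr
      nlinarith)
    (Set.right_mem_Icc.2 zero_le_one)
  simpa [zeroExt_coe] using key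

theorem norm_fn_le (f : Bloch n) (z : polydisk n) :
    ‖f.fn z‖ ≤ ‖f‖ * (1 + ∑ j, -Real.log (1 - ‖z.1 j‖)) := by
  have h1 := f.norm_fn_sub_fn_zero_le z
  have h2 := f.norm_fn_zero_le
  have h3 := norm_le_norm_sub_add (f.fn z) (f.fn (polydiskZero n))
  linarith

/-- Lets norm limits be identified through their pointwise values. -/
theorem continuous_fn_apply (z : polydisk n) : Continuous fun f : Bloch n => f.fn z := by
  let E : Bloch n →ₗ[ℂ] ℂ :=
    { toFun := fun f => f.fn z, map_add' := fun _ _ => rfl, map_smul' := fun _ _ => rfl }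
  exact (E.mkContinuous _ fun f => (f.norm_fn_le z).trans_eq (mul_comm _ _)).continuous

end Bloch

theorem blochOmega_le (z : polydisk n) :
    blochOmega z ≤ ENNReal.ofReal (∑ j, -Real.log (1 - ‖z.1 j‖)) := by
  refine iSup_le fun f => iSup_le fun h0 => iSup_le fun h1 => ENNReal.ofReal_le_ofReal ?_
  have h := f.norm_fn_sub_fn_zero_le z
  rw [h0, sub_zero] at h
  refine h.trans (mul_le_of_le_one_left (Finset.sum_nonneg fun j _ => ?_) h1)
  exact neg_nonneg.2 (Real.log_nonpos (one_sub_norm_pos z j).le (by simp))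

/-- A bounded holomorphic function has a derivative controlled by the Bergman metric. -/
theorem norm_gradApply_le_of_bounded {f : polydisk n → ℂ} (hf : IsHol f) {M : ℝ}
    (hM : ∀ z, ‖f z‖ ≤ M) (z : polydisk n) (u : Fin n → ℂ) :
    ‖gradApply f z u‖ ≤ 4 * M * √(bergmanH z u) := by
  by_cases hu : u = 0
  · simp [hu, gradApply, bergmanH]
  have hH : 0 < √(bergmanH z u) := Real.sqrt_pos.2 (bergmanH_pos z hu)
  -- On this disc `|t||u_j| < (1 - |z_j|²)/2 ≤ 1 - |z_j|`, so the slice in direction `u` stays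
  -- inside the polydisk.
  have hmem : ∀ t ∈ Metric.ball (0 : ℂ) (1 / (2 * √(bergmanH z u))),
      z.1 + t • u ∈ polydisk n := fun t ht j => by
    rw [mem_ball_zero_iff, lt_div_iff₀ (by positivity)] at ht
    have h1 := norm_div_le_sqrt_bergmanH z u j
    rw [div_le_iff₀ (one_sub_norm_sq_pos z j)] at h1
    have h2 := one_sub_norm_pos z j
    have h3 : ‖t‖ * ‖u j‖ ≤ ‖t‖ * √(bergmanH z u) * (2 * (1 - ‖z.1 j‖)) := by
      rw [mul_assoc]
      refine mul_le_mul_of_nonneg_left (h1.trans ?_) (norm_nonneg _)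
      exact mul_le_mul_of_nonneg_left (by nlinarith [norm_nonneg (z.1 j)]) hH.le
    calc ‖z.1 j + t * u j‖ ≤ ‖z.1 j‖ + ‖t‖ * ‖u j‖ := by
          simpa using norm_add_le (z.1 j) (t * u j)
      _ < 1 := by nlinarith
  have hd : ∀ t ∈ Metric.ball (0 : ℂ) (1 / (2 * √(bergmanH z u))),
      HasDerivAt (fun t : ℂ => zeroExt f (z.1 + t • u))
        (fderiv ℂ (zeroExt f) (z.1 + t • u) u) t := fun t ht => by
    have h2 : HasDerivAt (fun t : ℂ => z.1 + t • u) u t := by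
      simpa using ((hasDerivAt_id t).smul_const u).const_add z.1
    exact (hf.hasFDerivAt ⟨_, hmem t ht⟩).comp_hasDerivAt t h2
  have h0 : (0 : ℂ) ∈ Metric.ball (0 : ℂ) (1 / (2 * √(bergmanH z u))) :=
    Metric.mem_ball_self (by positivity)
  -- Schwarz's lemma on the slice: the oscillation is at most `2M` and the radius is `1/(2√H)`,
  -- hence the factor `4M`.
  have h := Complex.norm_deriv_le_div_of_mapsTo_ball (R₂ := 2 * M)
    (fun t ht => (hd t ht).differentiableAt.differentiableWithinAt)
    (fun t ht => by
      have e1 := zeroExt_coe f ⟨_, hmem t ht⟩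
      have e2 := zeroExt_coe f ⟨_, hmem 0 h0⟩
      dsimp only at e1 e2
      rw [mem_closedBall_iff_norm, e1, e2]
      exact (norm_sub_le _ _).trans (by linarith [hM ⟨_, hmem t ht⟩, hM ⟨_, hmem 0 h0⟩]))
    (by positivity)
  rw [(hd 0 h0).deriv] at h
  simp only [zero_smul, add_zero] at h
  refine h.trans_eq ?_
  field_simp
  ring

end Basic

/-! ### Test functions concentrated near a point of the polydisk. -/

section TestFunctions

open ComplexConjugate

/-- Of the two lower bounds for this denominator, this one is uniform in `a` and gives decay at
fixed `v`; the next is uniform in `v` and gives norm bounds. -/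
theorem one_sub_norm_le_norm_one_sub_conj_mul {a v : ℂ} (ha : ‖a‖ ≤ 1) :
    1 - ‖v‖ ≤ ‖1 - conj a * v‖ := by
  have h := norm_sub_norm_le (1 : ℂ) (conj a * v)
  rw [norm_one, norm_mul, RCLike.norm_conj] at h
  nlinarith [norm_nonneg v]

theorem one_sub_norm_le_norm_one_sub_conj_mul' {a v : ℂ} (hv : ‖v‖ ≤ 1) :
    1 - ‖a‖ ≤ ‖1 - conj a * v‖ := by
  have h := norm_sub_norm_le (1 : ℂ) (conj a * v)
  rw [norm_one, norm_mul, RCLike.norm_conj] at h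
  nlinarith [norm_nonneg a]

theorem one_sub_conj_mul_ne_zero {a v : ℂ} (ha : ‖a‖ < 1) (hv : ‖v‖ < 1) :
    1 - conj a * v ≠ 0 := by
  have h := one_sub_norm_le_norm_one_sub_conj_mul (v := v) ha.le
  rw [← norm_pos_iff]
  linarith

theorem norm_one_sub_conj_mul_le_two {a v : ℂ} (ha : ‖a‖ ≤ 1) (hv : ‖v‖ ≤ 1) :
    ‖1 - conj a * v‖ ≤ 2 := by
  have h := norm_sub_le (1 : ℂ) (conj a * v)
  rw [norm_one, norm_mul, RCLike.norm_conj] at h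
  nlinarith [norm_nonneg a, norm_nonneg v]

theorem one_sub_conj_mul_self (a : ℂ) : 1 - conj a * a = ((1 - ‖a‖ ^ 2 : ℝ) : ℂ) := by
  rw [mul_comm, Complex.mul_conj, Complex.normSq_eq_norm_sq]
  push_cast
  rfl

theorem norm_mobius_le_one {a v : ℂ} (ha : ‖a‖ < 1) (hv : ‖v‖ < 1) :
    ‖(v - a) / (1 - conj a * v)‖ ≤ 1 := by
  rw [norm_div]
  refine div_le_one_of_le₀ ?_ (norm_nonneg _)
  refine (sq_le_sq₀ (norm_nonneg _) (norm_nonneg _)).1 ?_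
  have h : ‖1 - conj a * v‖ ^ 2 - ‖v - a‖ ^ 2 = (1 - ‖v‖ ^ 2) * (1 - ‖a‖ ^ 2) := by
    simp only [← Complex.normSq_eq_norm_sq, Complex.normSq_apply, Complex.sub_re, Complex.sub_im,
      Complex.mul_re, Complex.mul_im, Complex.conj_re, Complex.conj_im, Complex.one_re,
      Complex.one_im]
    ring
  have h1 : 0 ≤ 1 - ‖v‖ ^ 2 := by nlinarith [norm_nonneg v]
  have h2 : 0 ≤ 1 - ‖a‖ ^ 2 := by nlinarith [norm_nonneg a]
  nlinarith [mul_nonneg h1 h2]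

/-- The `4` absorbs `π` from the argument and `log 2` from `‖w‖ ≤ 2`. -/
theorem norm_log_le {w : ℂ} {c : ℝ} (hc : 0 < c) (hcw : c ≤ ‖w‖) (hw : ‖w‖ ≤ 2) (hc1 : c ≤ 1) :
    ‖Complex.log w‖ ≤ 4 - Real.log c := by
  have h1 := Complex.norm_le_abs_re_add_abs_im (Complex.log w)
  rw [Complex.log_re, Complex.log_im] at h1
  have h2 := Complex.abs_arg_le_pi w
  have h3 := Real.log_le_log hc hcw
  have h4 := Real.log_le_log (hc.trans_le hcw) hw
  have h5 := Real.log_nonpos hc.le hc1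
  have h6 := Real.log_two_lt_d9
  have h7 := Real.log_two_gt_d9
  have h8 := Real.pi_lt_d2
  have h9 : |Real.log ‖w‖| ≤ Real.log 2 - Real.log c := abs_le.2 ⟨by linarith, by linarith⟩
  linarith

variable {n : ℕ}

theorem exists_norm_coord_eq (hn : 1 ≤ n) (a : Fin n → ℂ) : ∃ i, ‖a i‖ = ‖a‖ := by
  have : Nonempty (Fin n) := ⟨⟨0, hn⟩⟩
  obtain ⟨i, hi⟩ := Finite.exists_max fun i => ‖a i‖
  exact ⟨i, le_antisymm (norm_le_pi_norm a i) ((pi_norm_le_iff_of_nonempty a).2 hi)⟩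

/-- Bounded Bloch functions which vanish at `a`, whose derivative at `a` is extremal in the
direction of the `j`-th coordinate, and which tend to zero pointwise as `‖a‖ → 1`. -/
theorem exists_bloch_extremal_deriv (hn : 1 ≤ n) (a : polydisk n) (j : Fin n) :
    ∃ f : Bloch n, ‖f‖ ≤ 10 ∧ f.fn a = 0 ∧
      (∀ u, ‖gradApply f.fn a u‖ = ‖u j‖ / (1 - ‖a.1 j‖ ^ 2)) ∧
      ∀ v, ‖f.fn v‖ ≤ (1 - ‖a.1‖ ^ 2) / (1 - ‖v.1‖) := by
  obtain ⟨i, hi⟩ := exists_norm_coord_eq hn a.1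
  -- The Möbius factor in coordinate `j` supplies the zero and the extremal derivative at `a`. The
  -- second factor, in a coordinate `i` of largest modulus, equals `1` at `a` and forces the decay
  -- as `‖a‖ → 1`.
  let G : (Fin n → ℂ) → ℂ := fun v =>
    (v j - a.1 j) / (1 - conj (a.1 j) * v j) *
      (((1 - ‖a.1 i‖ ^ 2 : ℝ) : ℂ) / (1 - conj (a.1 i) * v i))
  have hne : ∀ v ∈ polydisk n, ∀ k, 1 - conj (a.1 k) * v k ≠ 0 := fun v hv k =>
    one_sub_conj_mul_ne_zero (a.2 k) (hv k)
  have hG : ∀ v ∈ polydisk n, DifferentiableAt ℂ G v := fun v hv => by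
    have h1 := hne v hv i
    have h2 := hne v hv j
    fun_prop (disch := assumption)
  have hv1 : ∀ v : polydisk n, ‖v.1‖ < 1 := fun v => mem_polydisk_iff_norm_lt.1 v.2
  have hpk : ∀ v : polydisk n, ‖G v‖ ≤ (1 - ‖a.1‖ ^ 2) / ‖1 - conj (a.1 i) * v.1 i‖ := fun v => by
    rw [norm_mul, norm_div (Complex.ofReal _), Complex.norm_real,
      Real.norm_of_nonneg (one_sub_norm_sq_pos a i).le, hi]
    refine mul_le_of_le_one_left ?_ (norm_mobius_le_one (a.2 j) (v.2 j))
    exact div_nonneg (hi ▸ (one_sub_norm_sq_pos a i).le) (norm_nonneg _)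
  have ha2 : 0 ≤ 1 - ‖a.1‖ ^ 2 := hi ▸ (one_sub_norm_sq_pos a i).le
  have hb1 : ∀ v : polydisk n, ‖G v‖ ≤ (1 - ‖a.1‖ ^ 2) / (1 - ‖v.1‖) := fun v => by
    refine (hpk v).trans (div_le_div_of_nonneg_left ha2 (sub_pos.2 (hv1 v)) ?_)
    refine le_trans ?_ (one_sub_norm_le_norm_one_sub_conj_mul (a.2 i).le)
    linarith [norm_le_pi_norm v.1 i]
  have hb2 : ∀ v : polydisk n, ‖G v‖ ≤ 2 := fun v => by
    refine (hpk v).trans (div_le_of_le_mul₀ (norm_nonneg _) zero_le_two ?_)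
    have h1 := one_sub_norm_le_norm_one_sub_conj_mul' (a := a.1 i) (v.2 i).le
    rw [hi] at h1
    nlinarith [norm_nonneg a.1, hv1 a]
  have hgrad := norm_gradApply_le_of_bounded (isHol_restrict hG) (M := 2) hb2
  refine ⟨Bloch.ofBound _ (isHol_restrict hG) _ (by norm_num) hgrad, ?_, ?_, ?_, hb1⟩
  -- `10 = 2 + 4 · 2`: the value at the origin plus the gradient bound for `M = 2`.
  · exact (Bloch.norm_le (by norm_num) (hb2 _) hgrad).trans (by norm_num)
  · change G a = 0
    simp [G]
  · intro u
    change ‖gradApply (fun w : polydisk n => G w) a u‖ = _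
    rw [gradApply_restrict]
    have hA : HasFDerivAt (fun v : Fin n → ℂ => (v j - a.1 j) / (1 - conj (a.1 j) * v j))
        ((1 / (1 - conj (a.1 j) * a.1 j)) •
          (ContinuousLinearMap.proj j : (Fin n → ℂ) →L[ℂ] ℂ)) a.1 := by
      have h1 : HasDerivAt (fun x : ℂ => (x - a.1 j) / (1 - conj (a.1 j) * x))
          (1 / (1 - conj (a.1 j) * a.1 j)) (a.1 j) := by
        have h := ((hasDerivAt_id (a.1 j)).sub_const (a.1 j)).div
          (((hasDerivAt_id (a.1 j)).const_mul (conj (a.1 j))).const_sub 1) (hne a.1 a.2 j)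
        refine HasDerivAt.congr_deriv (by exact h) ?_
        have := hne a.1 a.2 j
        simp only [id, sub_self, zero_mul, sub_zero, one_mul]
        field_simp
      exact h1.comp_hasFDerivAt a.1 (ContinuousLinearMap.proj j : (Fin n → ℂ) →L[ℂ] ℂ).hasFDerivAt
    -- Differentiability is enough here: the derivative of this factor gets multiplied by the Möbius
    -- factor, which vanishes at `a`.
    have hB : DifferentiableAt ℂ
        (fun v : Fin n → ℂ => ((1 - ‖a.1 i‖ ^ 2 : ℝ) : ℂ) / (1 - conj (a.1 i) * v i)) a.1 := by
      have h1 := hne a.1 a.2 i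
      fun_prop (disch := assumption)
    have hGa := (hA.mul hB.hasFDerivAt).fderiv
    change fderiv ℂ G a.1 = _ at hGa
    rw [hGa]
    have h2 := hne a.1 a.2 i
    simp only [one_sub_conj_mul_self] at h2 ⊢
    simp [h2, abs_of_pos (one_sub_norm_sq_pos a j), -Complex.ofReal_sub, div_eq_inv_mul]

/-- Bounded Bloch functions whose value at `a` is comparable to the largest one possible, and
which tend to zero pointwise as `‖a‖ → 1`. -/
theorem exists_bloch_extremal_value (hn : 1 ≤ n) (a : polydisk n)
    (ha : 1 ≤ -Real.log (1 - ‖a.1‖ ^ 2)) :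
    ∃ f : Bloch n, ‖f‖ ≤ 24 ∧ ‖f.fn a‖ = -Real.log (1 - ‖a.1‖ ^ 2) ∧
      ∀ v, ‖f.fn v‖ ≤ (4 - Real.log (1 - ‖v.1‖)) ^ 2 / -Real.log (1 - ‖a.1‖ ^ 2) := by
  obtain ⟨i, hi⟩ := exists_norm_coord_eq hn a.1
  have hai := a.2 i
  set b := a.1 i with hb
  rw [← hi] at ha ⊢
  set Λ : ℝ := -Real.log (1 - ‖b‖ ^ 2) with hΛ
  have hΛ0 : 0 < Λ := one_pos.trans_le ha
  have hb2 : 0 < 1 - ‖b‖ ^ 2 := one_sub_norm_sq_pos a i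
  -- Squaring before dividing by `Λ` leaves the value `Λ` at `b`, while at a fixed point the
  -- quotient tends to zero as `Λ → ∞`.
  let g : ℂ → ℂ := fun x => Complex.log (1 - conj b * x) ^ 2 / (Λ : ℂ)
  have hre : ∀ x : ℂ, ‖x‖ < 1 → 1 - conj b * x ∈ Complex.slitPlane := fun x hx => by
    left
    have h := Complex.re_le_norm (conj b * x)
    rw [norm_mul, RCLike.norm_conj] at h
    rw [Complex.sub_re, Complex.one_re]
    nlinarith [norm_nonneg b, norm_nonneg x]
  have hg : ∀ x : ℂ, ‖x‖ < 1 → HasDerivAt g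
      (2 * Complex.log (1 - conj b * x) * (-conj b / (1 - conj b * x)) / Λ) x := fun x hx => by
    have h := (((((hasDerivAt_id x).const_mul (conj b)).const_sub 1).clog (hre x hx)).pow
      2).div_const (Λ : ℂ)
    refine HasDerivAt.congr_deriv (by exact h) ?_
    simp
  have hg' : ∀ x : ℂ, ‖x‖ < 1 →
      ‖2 * Complex.log (1 - conj b * x) * (-conj b / (1 - conj b * x)) / Λ‖ ≤
        24 / (1 - ‖x‖ ^ 2) := fun x hx => by
    -- With `c = (1 - |b|²)/2 ≤ 1 - |b|` the bound is `4 + log 2 + Λ`, and `Λ ≥ 1`.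
    have h1 : ‖Complex.log (1 - conj b * x)‖ ≤ 6 * Λ := by
      refine (norm_log_le (c := (1 - ‖b‖ ^ 2) / 2) (by positivity) ?_
        (norm_one_sub_conj_mul_le_two hai.le hx.le) (by nlinarith [norm_nonneg b])).trans ?_
      · refine le_trans ?_ (one_sub_norm_le_norm_one_sub_conj_mul' hx.le)
        nlinarith [norm_nonneg b]
      · rw [Real.log_div hb2.ne' two_ne_zero]
        have := Real.log_two_lt_d9
        linarith
    have h2 : 1 - ‖x‖ ≤ ‖1 - conj b * x‖ := one_sub_norm_le_norm_one_sub_conj_mul hai.le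
    have h3 : 0 < 1 - ‖x‖ := sub_pos.2 hx
    have h4 : 0 < 1 - ‖x‖ ^ 2 := by nlinarith [norm_nonneg x]
    rw [norm_div, norm_mul, norm_mul, norm_div, norm_neg, RCLike.norm_conj, Complex.norm_real,
      Real.norm_of_nonneg hΛ0.le, RCLike.norm_ofNat]
    calc 2 * ‖Complex.log (1 - conj b * x)‖ * (‖b‖ / ‖1 - conj b * x‖) / Λ
        ≤ 2 * (6 * Λ) * (1 / (1 - ‖x‖)) / Λ := by gcongr
      _ = 12 / (1 - ‖x‖) := by field_simp; norm_num
      _ ≤ 24 / (1 - ‖x‖ ^ 2) := by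
        rw [div_le_div_iff₀ h3 h4]
        nlinarith [norm_nonneg x]
  let G : (Fin n → ℂ) → ℂ := fun v => g (v i)
  have hG : ∀ v ∈ polydisk n, HasFDerivAt G
      ((2 * Complex.log (1 - conj b * v i) * (-conj b / (1 - conj b * v i)) / Λ) •
        (ContinuousLinearMap.proj i : (Fin n → ℂ) →L[ℂ] ℂ)) v := fun v hv =>
    HasDerivAt.comp_hasFDerivAt (h₂ := g) v (hg (v i) (hv i))
      (ContinuousLinearMap.proj i : (Fin n → ℂ) →L[ℂ] ℂ).hasFDerivAt
  have hol : IsHol fun w : polydisk n => G w := isHol_restrict fun v hv => (hG v hv).differentiableAt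
  have hgrad : ∀ z u, ‖gradApply (fun w : polydisk n => G w) z u‖ ≤ 24 * √(bergmanH z u) :=
      fun z u => by
    rw [gradApply_restrict, (hG z z.2).fderiv]
    change ‖_ * u i‖ ≤ _
    rw [norm_mul]
    refine (mul_le_mul_of_nonneg_right (hg' _ (z.2 i)) (norm_nonneg _)).trans ?_
    rw [div_mul_eq_mul_div, mul_div_assoc]
    exact mul_le_mul_of_nonneg_left (norm_div_le_sqrt_bergmanH z u i) (by norm_num)
  refine ⟨Bloch.ofBound _ hol _ (by norm_num) hgrad, ?_, ?_, fun v => ?_⟩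
  · refine (Bloch.norm_le (A := 0) (by norm_num) ?_ hgrad).trans (by norm_num)
    change ‖G 0‖ ≤ 0
    simp [G, g]
  · change ‖Complex.log (1 - conj b * b) ^ 2 / (Λ : ℂ)‖ = Λ
    rw [one_sub_conj_mul_self, ← Complex.ofReal_log hb2.le, norm_div, norm_pow, Complex.norm_real,
      Complex.norm_real, Real.norm_of_nonneg hΛ0.le, ← norm_neg, ← hΛ, Real.norm_of_nonneg hΛ0.le]
    field_simp
  · change ‖Complex.log (1 - conj b * v.1 i) ^ 2 / (Λ : ℂ)‖ ≤ _
    have hv : 0 < 1 - ‖v.1‖ := sub_pos.2 (mem_polydisk_iff_norm_lt.1 v.2)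
    rw [norm_div, norm_pow, Complex.norm_real, Real.norm_of_nonneg hΛ0.le]
    gcongr
    refine norm_log_le hv ?_ (norm_one_sub_conj_mul_le_two hai.le (v.2 i).le)
      (by linarith [norm_nonneg v.1])
    exact le_trans (by linarith [norm_le_pi_norm v.1 i])
      (one_sub_norm_le_norm_one_sub_conj_mul hai.le)

end TestFunctions

/-! ### Pointwise estimates for the operator and the boundedness criterion. -/

section Operator

variable {n : ℕ}

theorem le_blochQ (f : polydisk n → ℂ) (z : polydisk n) {u : Fin n → ℂ} (hu : u ≠ 0) :
    ENNReal.ofReal (‖gradApply f z u‖ / √(bergmanH z u)) ≤ blochQ f z :=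
  le_iSup₂ (f := fun (u : Fin n → ℂ) (_ : u ≠ 0) =>
    ENNReal.ofReal (‖gradApply f z u‖ / √(bergmanH z u))) u hu

theorem blochQ_smul {f : polydisk n → ℂ} (hf : IsHol f) (c : ℂ) (z : polydisk n) :
    blochQ (c • f) z = ENNReal.ofReal ‖c‖ * blochQ f z := by
  simp only [blochQ, ENNReal.mul_iSup]
  refine iSup_congr fun u => iSup_congr fun _ => ?_
  rw [← ENNReal.ofReal_mul (norm_nonneg c), gradApply_smul hf, norm_mul, mul_div_assoc]

theorem blochQ_mul_comp_le {p g : polydisk n → ℂ} {φ : polydisk n → polydisk n} (hp : IsHol p)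
    (hg : IsHol g) (hφ : IsHol (fun z => (φ z : Fin n → ℂ))) (z : polydisk n) :
    blochQ (fun z => p z * g (φ z)) z ≤
      ENNReal.ofReal ‖g (φ z)‖ * blochQ p z + ENNReal.ofReal ‖p z‖ * blochQ (g ∘ φ) z := by
  refine iSup₂_le fun u hu => ?_
  refine le_trans ?_ (add_le_add (mul_le_mul_right (le_blochQ p z hu) _)
    (mul_le_mul_right (le_blochQ (g ∘ φ) z hu) _))
  rw [← ENNReal.ofReal_mul (norm_nonneg _), ← ENNReal.ofReal_mul (norm_nonneg _),
    ← ENNReal.ofReal_add (by positivity) (by positivity), ← mul_div_assoc, ← mul_div_assoc,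
    ← add_div, gradApply_mul_comp hp hg hφ, gradApply_comp hg hφ, ← norm_mul, ← norm_mul]
  exact ENNReal.ofReal_le_ofReal (by gcongr; exact norm_add_le _ _)

/-- The product rule solved for the term containing `∇p`; it isolates `ω Q_ψ` in the necessity
arguments. -/
theorem mul_blochQ_le {p g : polydisk n → ℂ} {φ : polydisk n → polydisk n} (hp : IsHol p)
    (hg : IsHol g) (hφ : IsHol (fun z => (φ z : Fin n → ℂ))) (z : polydisk n) :
    ENNReal.ofReal ‖g (φ z)‖ * blochQ p z ≤
      blochQ (fun z => p z * g (φ z)) z + ENNReal.ofReal ‖p z‖ * blochQ (g ∘ φ) z := by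
  rw [blochQ, ENNReal.mul_iSup]
  refine iSup_le fun u => ?_
  rw [ENNReal.mul_iSup]
  refine iSup_le fun hu => ?_
  refine le_trans ?_ (add_le_add (le_blochQ _ z hu)
    (mul_le_mul_right (le_blochQ (g ∘ φ) z hu) _))
  rw [← ENNReal.ofReal_mul (norm_nonneg _), ← ENNReal.ofReal_mul (norm_nonneg _),
    ← ENNReal.ofReal_add (by positivity) (by positivity), ← mul_div_assoc, ← mul_div_assoc,
    ← add_div, gradApply_mul_comp hp hg hφ, gradApply_comp hg hφ, ← norm_mul, ← norm_mul]
  refine ENNReal.ofReal_le_ofReal ?_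
  gcongr
  exact norm_le_add_norm_add _ _

theorem norm_inv_norm_smul_le_one {E : Type*} [NormedAddCommGroup E] [NormedSpace ℂ E] (x : E) :
    ‖((‖x‖⁻¹ : ℝ) : ℂ) • x‖ ≤ 1 := by
  rw [norm_smul, Complex.norm_real, norm_inv, norm_norm]
  exact inv_mul_le_one

theorem norm_smul_inv_norm_smul {E : Type*} [NormedAddCommGroup E] [NormedSpace ℂ E] (x : E) :
    (‖x‖ : ℂ) • ((‖x‖⁻¹ : ℝ) : ℂ) • x = x := by
  by_cases hx : x = 0
  · simp [hx]
  · rw [smul_smul, ← Complex.ofReal_mul, mul_inv_cancel₀ (norm_ne_zero_iff.2 hx), Complex.ofReal_one,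
      one_smul]

namespace Bloch

/-- Subtracting the constant `f(0)` does not increase the norm and, after scaling, gives a
competitor for `ω`. Since `0⁻¹ = 0`, the scaling needs no separate treatment of zero. -/
theorem ofReal_norm_fn_le (f : Bloch n) (z : polydisk n) :
    ENNReal.ofReal ‖f.fn z‖ ≤
      ENNReal.ofReal ‖f.fn (polydiskZero n)‖ + blochOmega z * ENNReal.ofReal ‖f‖ := by
  set g : Bloch n := f + const n (-f.fn (polydiskZero n)) with hg
  have hgz : ∀ v, g.fn v = f.fn v - f.fn (polydiskZero n) := fun v => (sub_eq_add_neg _ _).symm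
  have hgf : ‖g‖ ≤ ‖f‖ := by
    refine (norm_le (A := 0) (norm_nonneg f) (by simp [hgz]) fun w u => ?_).trans_eq (zero_add _)
    change ‖gradApply (f.fn + (const n (-f.fn (polydiskZero n))).fn) w u‖ ≤ _
    have h0 : gradApply (const n (-f.fn (polydiskZero n))).fn w u = 0 := gradApply_const _ w u
    rw [gradApply_add f.isHol (isHol _), h0, add_zero]
    exact f.norm_gradApply_le w u
  have hω : ENNReal.ofReal ‖(((‖g‖⁻¹ : ℝ) : ℂ) • g).fn z‖ ≤ blochOmega z :=
    le_iSup_of_le (((‖g‖⁻¹ : ℝ) : ℂ) • g) (le_iSup_of_le (by simp [smul_fn, hgz])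
      (le_iSup_of_le (norm_inv_norm_smul_le_one g) le_rfl))
  have hsplit : f.fn z = f.fn (polydiskZero n) + ‖g‖ * (((‖g‖⁻¹ : ℝ) : ℂ) • g).fn z := by
    rw [← smul_fn, norm_smul_inv_norm_smul, hgz]
    ring
  calc ENNReal.ofReal ‖f.fn z‖
      ≤ ENNReal.ofReal (‖f.fn (polydiskZero n)‖ + ‖(((‖g‖⁻¹ : ℝ) : ℂ) • g).fn z‖ * ‖f‖) := by
        refine ENNReal.ofReal_le_ofReal ?_
        conv_lhs => rw [hsplit]
        refine (norm_add_le _ _).trans ?_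
        rw [norm_mul, Complex.norm_real, norm_norm, mul_comm ‖g‖]
        gcongr
    _ ≤ _ := by
        rw [ENNReal.ofReal_add (norm_nonneg _) (by positivity), ENNReal.ofReal_mul (norm_nonneg _)]
        gcongr

theorem blochQ_comp_le (f : Bloch n) {φ : polydisk n → polydisk n}
    (hφ : IsHol (fun z => (φ z : Fin n → ℂ))) (z : polydisk n) :
    blochQ (f.fn ∘ φ) z ≤ blochT φ z * ENNReal.ofReal ‖f‖ := by
  have h := norm_inv_norm_smul_le_one f
  have hT : blochQ ((((‖f‖⁻¹ : ℝ) : ℂ) • f).fn ∘ φ) z ≤ blochT φ z :=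
    le_iSup_of_le (((‖f‖⁻¹ : ℝ) : ℂ) • f) (le_iSup_of_le
      ((beta_le_ofReal_norm _).trans (ENNReal.ofReal_le_one.2 h)) le_rfl)
  have hsplit : f.fn ∘ φ = (‖f‖ : ℂ) • ((((‖f‖⁻¹ : ℝ) : ℂ) • f).fn ∘ φ) := by
    conv_lhs => rw [← norm_smul_inv_norm_smul f]
    rfl
  rw [hsplit, blochQ_smul ((isHol _).comp hφ), Complex.norm_real, norm_norm, mul_comm]
  gcongr

end Bloch

variable {ψ : polydisk n → ℂ} {φ : polydisk n → polydisk n} {T : Bloch n →L[ℂ] Bloch n}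

theorem IsWCO.fn_eq (hT : IsWCO ψ φ T) (f : Bloch n) :
    (T f).fn = fun z => ψ z * f.fn (φ z) := funext (hT f)

theorem IsWCO.apply_const_one (hT : IsWCO ψ φ T) : (T (Bloch.const n 1)).fn = ψ := by
  rw [hT.fn_eq]
  funext z
  exact mul_one _

theorem IsWCO.mem_blochSubmodule (hT : IsWCO ψ φ T) : ψ ∈ blochSubmodule n := by
  rw [← hT.apply_const_one]
  exact (T (Bloch.const n 1)).2

/-- The weighted derivative of a composition is controlled by the action of the operator on
functions with extremal derivatives. -/
theorem IsWCO.mul_blochQ_comp_le (hT : IsWCO ψ φ T) (hψ : IsHol ψ)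
    (hφ : IsHol (fun z => (φ z : Fin n → ℂ))) {z : polydisk n} {F : Fin n → Bloch n}
    (hF0 : ∀ j, (F j).fn (φ z) = 0)
    (hF : ∀ j v, ‖gradApply (F j).fn (φ z) v‖ = ‖v j‖ / (1 - ‖(φ z).1 j‖ ^ 2))
    {g : polydisk n → ℂ} (hg : IsHol g) {M : ℝ} (hM : 0 ≤ M)
    (hgM : ∀ v, ‖gradApply g (φ z) v‖ ≤ M * ∑ j, ‖v j‖ / (1 - ‖(φ z).1 j‖ ^ 2)) :
    ENNReal.ofReal ‖ψ z‖ * blochQ (g ∘ φ) z ≤ ENNReal.ofReal (M * ∑ j, ‖T (F j)‖) := by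
  rw [← blochQ_smul (hg.comp hφ), blochQ_le_ofReal_iff (by positivity)]
  intro u
  rw [gradApply_smul (hg.comp hφ), gradApply_comp hg hφ, norm_mul]
  set v := fderiv ℂ (zeroExt fun z => (φ z : Fin n → ℂ)) z u with hv
  -- Since `F j` vanishes at `φ z`, the product rule for `T (F j)` retains only the term with `ψ z`.
  have key : ∀ j, ‖ψ z‖ * (‖v j‖ / (1 - ‖(φ z).1 j‖ ^ 2)) ≤ ‖T (F j)‖ * √(bergmanH z u) :=
    fun j => by
      have h := (T (F j)).norm_gradApply_le z u
      rwa [hT.fn_eq, gradApply_mul_comp hψ (F j).isHol hφ, hF0, zero_mul, zero_add, norm_mul,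
        hF] at h
  calc ‖ψ z‖ * ‖gradApply g (φ z) v‖
      ≤ ‖ψ z‖ * (M * ∑ j, ‖v j‖ / (1 - ‖(φ z).1 j‖ ^ 2)) := by gcongr; exact hgM v
    _ = M * ∑ j, ‖ψ z‖ * (‖v j‖ / (1 - ‖(φ z).1 j‖ ^ 2)) := by rw [← Finset.mul_sum]; ring
    _ ≤ M * ∑ j, ‖T (F j)‖ * √(bergmanH z u) := 
        mul_le_mul_of_nonneg_left (Finset.sum_le_sum fun j _ => key j) hM
    _ = _ := by rw [← Finset.sum_mul, mul_assoc]

theorem IsWCO.mul_blochT_le (hT : IsWCO ψ φ T) (hψ : IsHol ψ)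
    (hφ : IsHol (fun z => (φ z : Fin n → ℂ))) {z : polydisk n} {F : Fin n → Bloch n}
    (hF0 : ∀ j, (F j).fn (φ z) = 0)
    (hF : ∀ j v, ‖gradApply (F j).fn (φ z) v‖ = ‖v j‖ / (1 - ‖(φ z).1 j‖ ^ 2)) :
    ENNReal.ofReal ‖ψ z‖ * blochT φ z ≤ ENNReal.ofReal (∑ j, ‖T (F j)‖) := by
  rw [blochT, ENNReal.mul_iSup]
  refine iSup_le fun g => ?_
  rw [ENNReal.mul_iSup]
  refine iSup_le fun hg => ?_
  rw [← one_mul (∑ j, ‖T (F j)‖)]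
  refine hT.mul_blochQ_comp_le hψ hφ hF0 hF g.isHol zero_le_one fun v => ?_
  rw [← ENNReal.ofReal_one, blochBeta_le_ofReal_iff zero_le_one] at hg
  exact (hg _ v).trans (mul_le_mul_of_nonneg_left (sqrt_bergmanH_le_sum _ v) zero_le_one)

/-- The product `f(φ(z)) Q_ψ(z)` is controlled by the operator and by `|ψ(z)| T_φ(z)`. -/
theorem IsWCO.fn_mul_blochQ_le (hT : IsWCO ψ φ T) (hψ : IsHol ψ)
    (hφ : IsHol (fun z => (φ z : Fin n → ℂ))) (f : Bloch n) (z : polydisk n) :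
    ENNReal.ofReal ‖f.fn (φ z)‖ * blochQ ψ z ≤
      ENNReal.ofReal ‖T f‖ + ENNReal.ofReal ‖ψ z‖ * blochT φ z * ENNReal.ofReal ‖f‖ := by
  refine (mul_blochQ_le hψ f.isHol hφ z).trans (add_le_add ?_ ?_)
  · rw [← hT.fn_eq]
    exact (blochQ_le_blochBeta _ z).trans (T f).beta_le_ofReal_norm
  · rw [mul_assoc]
    gcongr
    exact f.blochQ_comp_le hφ z

/-- The pointwise estimate behind the sufficiency of the boundedness conditions. -/
theorem blochQ_mul_fn_comp_le (hψ : IsHol ψ) (hφ : IsHol (fun z => (φ z : Fin n → ℂ)))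
    (f : Bloch n) (z : polydisk n) :
    blochQ (fun z => ψ z * f.fn (φ z)) z ≤
      ENNReal.ofReal ‖f.fn (polydiskZero n)‖ * blochQ ψ z +
        (blochOmega (φ z) * blochQ ψ z + ENNReal.ofReal ‖ψ z‖ * blochT φ z) *
          ENNReal.ofReal ‖f‖ := by
  refine (blochQ_mul_comp_le hψ f.isHol hφ z).trans ?_
  calc _ ≤ (ENNReal.ofReal ‖f.fn (polydiskZero n)‖ + blochOmega (φ z) * ENNReal.ofReal ‖f‖) *
        blochQ ψ z + ENNReal.ofReal ‖ψ z‖ * (blochT φ z * ENNReal.ofReal ‖f‖) := by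
        gcongr
        · exact f.ofReal_norm_fn_le (φ z)
        · exact f.blochQ_comp_le hφ z
    _ = _ := by ring

theorem IsWCO.wcoTau_lt_top (hn : 1 ≤ n) (hT : IsWCO ψ φ T) (hψ : IsHol ψ)
    (hφ : IsHol (fun z => (φ z : Fin n → ℂ))) : wcoTau ψ φ < ⊤ := by
  refine lt_of_le_of_lt (iSup_le fun z => ?_)
    (ENNReal.ofReal_lt_top (r := ∑ _j : Fin n, ‖T‖ * 10))
  choose F hF h0 hd _ using exists_bloch_extremal_deriv hn (φ z)
  refine (hT.mul_blochT_le hψ hφ h0 hd).trans (ENNReal.ofReal_le_ofReal ?_)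
  exact Finset.sum_le_sum fun j _ => T.le_opNorm_of_le (hF j)

/-- No special test function is needed: each competitor for `ω` is tested itself, and `τ` absorbs
the remaining term. -/
theorem IsWCO.wcoSigma_lt_top (hn : 1 ≤ n) (hT : IsWCO ψ φ T) (hψ : IsHol ψ)
    (hφ : IsHol (fun z => (φ z : Fin n → ℂ))) : wcoSigma ψ φ < ⊤ := by
  refine lt_of_le_of_lt (iSup_le fun z => ?_)
    (ENNReal.add_lt_top.2 ⟨ENNReal.ofReal_lt_top (r := ‖T‖), hT.wcoTau_lt_top hn hψ hφ⟩)
  simp only [blochOmega, ENNReal.iSup_mul]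
  refine iSup_le fun f => iSup_le fun _ => iSup_le fun hf => ?_
  refine (hT.fn_mul_blochQ_le hψ hφ f z).trans (add_le_add ?_ ?_)
  · exact ENNReal.ofReal_le_ofReal (by simpa using T.le_opNorm_of_le hf)
  · refine le_trans (mul_le_of_le_one_right' (ENNReal.ofReal_le_one.2 hf)) ?_
    exact le_iSup (fun z => ENNReal.ofReal ‖ψ z‖ * blochT φ z) z

theorem blochBeta_mul_fn_comp_le (hψ : IsHol ψ) (hφ : IsHol (fun z => (φ z : Fin n → ℂ)))
    (f : Bloch n) : blochBeta (fun z => ψ z * f.fn (φ z)) ≤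
      (blochBeta ψ + (wcoSigma ψ φ + wcoTau ψ φ)) * ENNReal.ofReal ‖f‖ := by
  refine iSup_le fun z => (blochQ_mul_fn_comp_le hψ hφ f z).trans ?_
  rw [add_mul (blochBeta ψ), mul_comm (blochBeta ψ)]
  gcongr
  · exact f.norm_fn_zero_le
  · exact blochQ_le_blochBeta ψ z
  · exact le_iSup (fun z => blochOmega (φ z) * blochQ ψ z) z
  · exact le_iSup (fun z => ENNReal.ofReal ‖ψ z‖ * blochT φ z) z

theorem exists_isWCO (hψ : ψ ∈ blochSubmodule n) (hφ : IsHol (fun z => (φ z : Fin n → ℂ)))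
    (hσ : wcoSigma ψ φ < ⊤) (hτ : wcoTau ψ φ < ⊤) :
    ∃ T : Bloch n →L[ℂ] Bloch n, IsWCO ψ φ T := by
  have hB : blochBeta ψ + (wcoSigma ψ φ + wcoTau ψ φ) < ⊤ :=
    ENNReal.add_lt_top.2 ⟨hψ.2, ENNReal.add_lt_top.2 ⟨hσ, hτ⟩⟩
  let L : Bloch n →ₗ[ℂ] Bloch n :=
    { toFun := fun f => ⟨fun z => ψ z * f.fn (φ z), hψ.1.mul_comp f.isHol hφ,
        (blochBeta_mul_fn_comp_le hψ.1 hφ f).trans_lt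
          (ENNReal.mul_lt_top hB ENNReal.ofReal_lt_top)⟩
      map_add' := fun f g => Bloch.fn_injective (funext fun z => mul_add _ _ _)
      map_smul' := fun c f => Bloch.fn_injective (funext fun z => mul_left_comm _ _ _) }
  refine ⟨L.mkContinuous
    (‖ψ (polydiskZero n)‖ * (1 + ∑ j, -Real.log (1 - ‖(φ (polydiskZero n)).1 j‖)) +
      (blochBeta ψ + (wcoSigma ψ φ + wcoTau ψ φ)).toReal) fun f => ?_, fun f z => rfl⟩
  rw [Bloch.norm_def, add_mul]
  refine add_le_add ?_ ?_
  · change ‖ψ (polydiskZero n) * f.fn (φ (polydiskZero n))‖ ≤ _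
    rw [norm_mul, mul_assoc]
    gcongr
    exact (f.norm_fn_le _).trans_eq (mul_comm _ _)
  · have h := ENNReal.toReal_mono (ENNReal.mul_lt_top hB ENNReal.ofReal_lt_top).ne
      (blochBeta_mul_fn_comp_le hψ.1 hφ f)
    rwa [ENNReal.toReal_mul, ENNReal.toReal_ofReal (norm_nonneg f)] at h

end Operator

/-! ### Compactness implies the two boundary limits. -/

section Necessity

variable {n : ℕ} {ψ : polydisk n → ℂ} {φ : polydisk n → polydisk n} {T : Bloch n →L[ℂ] Bloch n}

/-- The polydisk is the unit ball of the sup norm. A neighbourhood of the sphere omits a compact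
part of the closed ball, where the norm attains a maximum below `1`. -/
theorem mem_toBoundary_iff {s : Set (polydisk n)} :
    s ∈ toBoundary φ ↔ ∃ r < 1, ∀ z, r < ‖(φ z).1‖ → z ∈ s := by
  have hfr : frontier (polydisk n) = Metric.sphere 0 1 := by
    rw [polydisk_eq_ball, frontier_ball _ one_ne_zero]
  rw [toBoundary, hfr, mem_comap]
  constructor
  · rintro ⟨U, hU, hUs⟩
    obtain ⟨V, hVo, hV, hVU⟩ := mem_nhdsSet_iff_exists.1 hU
    have hz1 : ∀ z, ‖(φ z).1‖ < 1 := fun z => mem_polydisk_iff_norm_lt.1 (φ z).2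
    have hK : IsCompact (Metric.closedBall (0 : Fin n → ℂ) 1 \ V) :=
      (isCompact_closedBall 0 1).diff hVo
    rcases (Metric.closedBall (0 : Fin n → ℂ) 1 \ V).eq_empty_or_nonempty with h | h
    · refine ⟨0, one_pos, fun z _ => hUs (hVU ?_)⟩
      exact Set.sdiff_eq_empty.1 h (mem_closedBall_zero_iff.2 (hz1 z).le)
    · obtain ⟨k, hk, hmax⟩ := hK.exists_isMaxOn h continuous_norm.continuousOn
      refine ⟨‖k‖, lt_of_le_of_ne (mem_closedBall_zero_iff.1 hk.1) fun h1 =>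
        hk.2 (hV (mem_sphere_zero_iff_norm.2 h1)), fun z hz => hUs (hVU ?_)⟩
      by_contra hzV
      exact (hmax ⟨mem_closedBall_zero_iff.2 (hz1 z).le, hzV⟩).not_gt hz
  · rintro ⟨r, hr, h⟩
    refine ⟨{w | r < ‖w‖}, (isOpen_lt continuous_const continuous_norm).mem_nhdsSet.2
      fun w hw => ?_, fun z hz => h z hz⟩
    rw [Set.mem_ofPred_eq, mem_sphere_zero_iff_norm.1 hw]
    exact hr

theorem tendsto_norm_toBoundary (φ : polydisk n → polydisk n) :
    Tendsto (fun z => ‖(φ z).1‖) (toBoundary φ) (𝓝[<] 1) := by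
  have hz1 : ∀ z, ‖(φ z).1‖ < 1 := fun z => mem_polydisk_iff_norm_lt.1 (φ z).2
  refine tendsto_nhdsWithin_iff.2 ⟨tendsto_order.2 ⟨fun r hr => ?_, fun r hr => ?_⟩,
    Eventually.of_forall hz1⟩
  · exact mem_toBoundary_iff.2 ⟨r, hr, fun _ h => h⟩
  · exact Eventually.of_forall fun z => (hz1 z).trans hr

theorem tendsto_one_sub_norm_sq_toBoundary (φ : polydisk n → polydisk n) :
    Tendsto (fun z => 1 - ‖(φ z).1‖ ^ 2) (toBoundary φ) (𝓝[>] 0) := by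
  refine tendsto_nhdsWithin_iff.2 ⟨?_, Eventually.of_forall fun z => ?_⟩
  · have h := ((tendsto_nhdsWithin_iff.1 (tendsto_norm_toBoundary φ)).1.pow 2).const_sub 1
    simpa using h
  · have h := mem_polydisk_iff_norm_lt.1 (φ z).2
    exact sub_pos.2 (pow_lt_one₀ (norm_nonneg _) h two_ne_zero)

theorem tendsto_neg_log_toBoundary (φ : polydisk n → polydisk n) :
    Tendsto (fun z => -Real.log (1 - ‖(φ z).1‖ ^ 2)) (toBoundary φ) atTop :=
  tendsto_neg_atBot_atTop.comp
    (Real.tendsto_log_nhdsGT_zero.comp (tendsto_one_sub_norm_sq_toBoundary φ))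

/-- A compact weighted composition operator maps bounded families which tend to zero pointwise
to families which tend to zero in norm. -/
theorem IsWCO.tendsto_norm_apply_zero (hT : IsWCO ψ φ T) (hc : IsCompactOperator T) {ι : Type*}
    {l : Filter ι} {f : ι → Bloch n} {M : ℝ} (hM : ∀ᶠ i in l, ‖f i‖ ≤ M)
    (hf : ∀ v, Tendsto (fun i => (f i).fn v) l (𝓝 0)) :
    Tendsto (fun i => ‖T (f i)‖) l (𝓝 0) := by
  obtain ⟨K, hK, hTK⟩ := IsCompactOperator.image_closedBall_subset_compact
    (f := (T : Bloch n →ₗ[ℂ] Bloch n)) hc M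
  refine tendsto_zero_iff_norm_tendsto_zero.1 (hK.tendsto_nhds_of_unique_mapClusterPt
    (hM.mono fun i hi => hTK ⟨f i, mem_closedBall_zero_iff.2 hi, rfl⟩) fun h _ hh => ?_)
  -- Along this ultrafilter the images converge in norm, hence pointwise; their pointwise limit is
  -- `0`, so every cluster point is `0`.
  obtain ⟨U, hU, hUh⟩ := mapClusterPt_iff_ultrafilter.1 hh
  refine Bloch.fn_injective (funext fun v => ?_)
  have h1 := ((Bloch.continuous_fn_apply v).tendsto h).comp hUh
  have h2 : Tendsto (fun i => ψ v * (f i).fn (φ v)) U (𝓝 (ψ v * 0)) :=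
    ((hf (φ v)).mono_left hU).const_mul _
  rw [mul_zero] at h2
  refine tendsto_nhds_unique h1 (h2.congr fun i => ?_)
  exact (hT (f i) v).symm

theorem IsWCO.tendsto_mul_blochT (hn : 1 ≤ n) (hT : IsWCO ψ φ T) (hc : IsCompactOperator T)
    (hψ : IsHol ψ) (hφ : IsHol (fun z => (φ z : Fin n → ℂ))) :
    Tendsto (fun z => ENNReal.ofReal ‖ψ z‖ * blochT φ z) (toBoundary φ) (𝓝 0) := by
  choose F hF h0 hd hp using fun z => exists_bloch_extremal_deriv hn (φ z)
  have hlim : ∀ j, Tendsto (fun z => ‖T (F z j)‖) (toBoundary φ) (𝓝 0) := fun j =>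
    hT.tendsto_norm_apply_zero hc (Eventually.of_forall fun z => hF z j) fun v => by
      refine squeeze_zero_norm (fun z => hp z j v) ?_
      simpa using (tendsto_nhdsWithin_iff.1 (tendsto_one_sub_norm_sq_toBoundary φ)).1.div_const
        (1 - ‖v.1‖)
  have hsum := ENNReal.tendsto_ofReal (tendsto_finsetSum Finset.univ fun j _ => hlim j)
  rw [Finset.sum_const_zero, ENNReal.ofReal_zero] at hsum
  exact tendsto_of_tendsto_of_tendsto_of_le_of_le tendsto_const_nhds hsum (fun _ => zero_le)
    fun z => hT.mul_blochT_le hψ hφ (h0 z) (hd z)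

/-- Makes `ω` comparable to the value of the logarithmic test function: each of the `n` coordinates
contributes at most `Λ + log 2 ≤ 2Λ`. -/
theorem blochOmega_le_log (a : polydisk n) (ha : 1 ≤ -Real.log (1 - ‖a.1‖ ^ 2)) :
    blochOmega a ≤
      ENNReal.ofReal (2 * n) * ENNReal.ofReal (-Real.log (1 - ‖a.1‖ ^ 2)) := by
  rw [← ENNReal.ofReal_mul (by positivity)]
  refine (blochOmega_le a).trans (ENNReal.ofReal_le_ofReal ?_)
  have h1 : ‖a.1‖ < 1 := mem_polydisk_iff_norm_lt.1 a.2
  have h2 : 0 < 1 - ‖a.1‖ ^ 2 := by nlinarith [norm_nonneg a.1]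
  have h : ∀ j ∈ Finset.univ, -Real.log (1 - ‖a.1 j‖) ≤ 2 * -Real.log (1 - ‖a.1‖ ^ 2) :=
    fun j _ => by
      have h3 : (1 - ‖a.1‖ ^ 2) / 2 ≤ 1 - ‖a.1 j‖ := by
        nlinarith [norm_le_pi_norm a.1 j, norm_nonneg a.1]
      have h4 := Real.log_le_log (by positivity) h3
      rw [Real.log_div h2.ne' two_ne_zero] at h4
      have := Real.log_two_lt_d9
      linarith
  refine (Finset.sum_le_sum h).trans_eq ?_
  rw [Finset.sum_const, Finset.card_univ, Fintype.card_fin, nsmul_eq_mul]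
  ring

theorem IsWCO.tendsto_blochOmega_mul (hn : 1 ≤ n) (hT : IsWCO ψ φ T) (hc : IsCompactOperator T)
    (hψ : IsHol ψ) (hφ : IsHol (fun z => (φ z : Fin n → ℂ))) :
    Tendsto (fun z => blochOmega (φ z) * blochQ ψ z) (toBoundary φ) (𝓝 0) := by
  have hΛ := tendsto_neg_log_toBoundary φ
  have hev := hΛ.eventually_ge_atTop 1
  have hex : ∀ z, ∃ f : Bloch n, 1 ≤ -Real.log (1 - ‖(φ z).1‖ ^ 2) → ‖f‖ ≤ 24 ∧
      ‖f.fn (φ z)‖ = -Real.log (1 - ‖(φ z).1‖ ^ 2) ∧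
      ∀ v, ‖f.fn v‖ ≤ (4 - Real.log (1 - ‖v.1‖)) ^ 2 / -Real.log (1 - ‖(φ z).1‖ ^ 2) :=
    fun z => by
      by_cases h : 1 ≤ -Real.log (1 - ‖(φ z).1‖ ^ 2)
      · obtain ⟨f, hf⟩ := exists_bloch_extremal_value hn (φ z) h
        exact ⟨f, fun _ => hf⟩
      · exact ⟨0, fun h' => absurd h' h⟩
  choose f hf using hex
  have hlim : Tendsto (fun z => ‖T (f z)‖) (toBoundary φ) (𝓝 0) :=
    hT.tendsto_norm_apply_zero hc (hev.mono fun z hz => (hf z hz).1) fun v =>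
      squeeze_zero_norm' (hev.mono fun z hz => (hf z hz).2.2 v) (hΛ.const_div_atTop _)
  have hlim' := ENNReal.Tendsto.const_mul (a := ENNReal.ofReal (2 * n))
    ((ENNReal.tendsto_ofReal hlim).add (ENNReal.Tendsto.mul_const (b := ENNReal.ofReal 24)
      (hT.tendsto_mul_blochT hn hc hψ hφ) (Or.inr ENNReal.ofReal_ne_top)))
    (Or.inr ENNReal.ofReal_ne_top)
  rw [ENNReal.ofReal_zero, zero_mul, add_zero, mul_zero] at hlim'
  refine tendsto_of_tendsto_of_tendsto_of_le_of_le' tendsto_const_nhds hlim'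
    (Eventually.of_forall fun _ => zero_le) (hev.mono fun z hz => ?_)
  obtain ⟨h1, h2, _⟩ := hf z hz
  calc blochOmega (φ z) * blochQ ψ z
      ≤ ENNReal.ofReal (2 * n) * ENNReal.ofReal ‖(f z).fn (φ z)‖ * blochQ ψ z := by
        rw [h2]
        gcongr
        exact blochOmega_le_log _ hz
    _ ≤ _ := by
        rw [mul_assoc]
        gcongr
        refine (hT.fn_mul_blochQ_le hψ hφ (f z) z).trans ?_
        gcongr

end Necessity

/-! ### Normal families, and compactness from the boundary limits. -/

section Sufficiency

variable {n : ℕ} {ψ : polydisk n → ℂ} {φ : polydisk n → polydisk n} {T : Bloch n →L[ℂ] Bloch n}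

theorem Bloch.norm_fderiv_le (f : Bloch n) {z : Fin n → ℂ} {R : ℝ} (hz : ‖z‖ ≤ R) (hR : R < 1) :
    ‖fderiv ℂ (zeroExt f.fn) z‖ ≤ ‖f‖ * (n / (1 - R ^ 2)) := by
  have hz1 : z ∈ polydisk n := mem_polydisk_iff_norm_lt.2 (hz.trans_lt hR)
  have hR0 : 0 ≤ R := (norm_nonneg z).trans hz
  have hR2 : 0 < 1 - R ^ 2 := by nlinarith
  refine ContinuousLinearMap.opNorm_le_bound _ (by positivity) fun u => ?_
  refine (f.norm_gradApply_le ⟨z, hz1⟩ u).trans ?_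
  rw [mul_assoc]
  gcongr
  have h : ∀ j ∈ Finset.univ, ‖u j‖ / (1 - ‖z j‖ ^ 2) ≤ ‖u‖ / (1 - R ^ 2) := fun j _ => by
    gcongr
    · exact norm_le_pi_norm u j
    · exact (norm_le_pi_norm z j).trans hz
  refine (sqrt_bergmanH_le_sum _ u).trans ((Finset.sum_le_sum h).trans_eq ?_)
  rw [Finset.sum_const, Finset.card_univ, Fintype.card_fin, nsmul_eq_mul]
  ring

/-- Cauchy's estimate for the derivative. -/
theorem IsHol.norm_fderiv_le {f : polydisk n → ℂ} (hf : IsHol f) {r R δ : ℝ} (hrR : r < R)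
    (hR : R ≤ 1) (hδ : ∀ v : polydisk n, ‖v.1‖ ≤ R → ‖f v‖ ≤ δ) {z : Fin n → ℂ} (hz : ‖z‖ ≤ r) :
    ‖fderiv ℂ (zeroExt f) z‖ ≤ 2 * δ / (R - r) := by
  have hmem : ∀ v ∈ Metric.ball z (R - r), ‖v‖ < R := fun v hv => by
    have h := norm_le_norm_sub_add v z
    rw [mem_ball_iff_norm] at hv
    linarith
  have hle : ∀ v ∈ Metric.ball z (R - r), ‖zeroExt f v‖ ≤ δ := fun v hv => by
    have h1 := hmem v hv
    have h2 := zeroExt_coe f ⟨v, mem_polydisk_iff_norm_lt.2 (h1.trans_le hR)⟩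
    dsimp only at h2
    rw [h2]
    exact hδ _ h1.le
  refine Complex.norm_fderiv_le_div_of_mapsTo_ball (R₂ := 2 * δ) (fun v hv => ?_) (fun v hv => ?_)
    (sub_pos.2 hrR)
  · have hv' := mem_polydisk_iff_norm_lt.2 ((hmem v hv).trans_le hR)
    exact (hf.hasFDerivAt ⟨v, hv'⟩).differentiableAt.differentiableWithinAt
  · rw [mem_closedBall_iff_norm]
    have h1 := hle v hv
    have h2 := hle z (Metric.mem_ball_self (sub_pos.2 hrR))
    exact (norm_sub_le _ _).trans (by linarith)

/-- Bounded families of Bloch functions which tend to zero pointwise do so uniformly on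
compact subsets. -/
theorem Bloch.eventually_norm_fn_le {ι : Type*} {l : Filter ι} {f : ι → Bloch n} {M : ℝ}
    (hM : ∀ᶠ i in l, ‖f i‖ ≤ M) (hf : ∀ v, Tendsto (fun i => (f i).fn v) l (𝓝 0)) {R δ : ℝ}
    (hR : R < 1) (hδ : 0 < δ) : ∀ᶠ i in l, ∀ v : polydisk n, ‖v.1‖ ≤ R → ‖(f i).fn v‖ ≤ δ := by
  -- A common Lipschitz constant on the ball of radius `R`; the absolute values keep it nonnegative
  -- before any sign is known. A finite net of mesh `δ/(2(C+1))` then suffices.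
  set C : ℝ := |M| * (n / |1 - R ^ 2|) with hC
  have hC0 : 0 ≤ C := by positivity
  have he : 0 < δ / (2 * (C + 1)) := by positivity
  obtain ⟨t, htR, htf, htc⟩ :=
    (isCompact_closedBall (0 : Fin n → ℂ) R).finite_cover_balls he
  have hpt : ∀ᶠ i in l, ∀ x ∈ t, ‖zeroExt (f i).fn x‖ ≤ δ / 2 := by
    refine (eventually_all_finite htf).2 fun x hx => ?_
    have hx1 : x ∈ polydisk n :=
      mem_polydisk_iff_norm_lt.2 ((mem_closedBall_zero_iff.1 (htR hx)).trans_lt hR)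
    have h := (tendsto_zero_iff_norm_tendsto_zero.1 (hf ⟨x, hx1⟩)).eventually_le_const
      (half_pos hδ)
    filter_upwards [h] with i hi
    have h2 := zeroExt_coe (f i).fn ⟨x, hx1⟩
    dsimp only at h2
    rwa [h2]
  filter_upwards [hM, hpt] with i hi hti v hv
  have hvm : v.1 ∈ Metric.closedBall (0 : Fin n → ℂ) R := mem_closedBall_zero_iff.2 hv
  obtain ⟨x, hx, hvx⟩ := Set.mem_iUnion₂.1 (htc hvm)
  have hR0 : 0 ≤ R := (norm_nonneg _).trans hv
  have hR2 : 0 < 1 - R ^ 2 := by nlinarith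
  have hlip := (convex_closedBall (0 : Fin n → ℂ) R).norm_image_sub_le_of_norm_fderiv_le
    (𝕜 := ℂ) (f := zeroExt (f i).fn) (C := C)
    (fun y hy => (f i).isHol.differentiableAt
      ⟨y, mem_polydisk_iff_norm_lt.2 ((mem_closedBall_zero_iff.1 hy).trans_lt hR)⟩)
    (fun y hy => by
      refine ((f i).norm_fderiv_le (mem_closedBall_zero_iff.1 hy) hR).trans ?_
      rw [hC, abs_of_pos hR2]
      gcongr
      exact hi.trans (le_abs_self M)) (htR hx) hvm
  rw [mem_ball_iff_norm] at hvx
  have h1 : C * ‖v.1 - x‖ ≤ δ / 2 := by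
    have h2 : (C + 1) * ‖v.1 - x‖ ≤ (C + 1) * (δ / (2 * (C + 1))) := by gcongr
    have h3 : (C + 1) * (δ / (2 * (C + 1))) = δ / 2 := by field_simp
    nlinarith [norm_nonneg (v.1 - x)]
  have h4 := norm_le_norm_sub_add (zeroExt (f i).fn v) (zeroExt (f i).fn x)
  rw [← zeroExt_coe (f i).fn]
  linarith [hti x hx]

theorem exists_tendsto_of_eventually_norm_le {α E : Type*} [NormedAddCommGroup E] [ProperSpace E]
    (U : Ultrafilter α) {g : α → E} {C : ℝ} (h : ∀ᶠ i in (U : Filter α), ‖g i‖ ≤ C) :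
    ∃ x, Tendsto g U (𝓝 x) := by
  obtain ⟨x, _, hx⟩ := (isCompact_closedBall (0 : E) C).ultrafilter_le_nhds' (U.map g)
    (h.mono fun i hi => mem_closedBall_zero_iff.2 hi)
  exact ⟨x, hx⟩

theorem Bloch.fderiv_zeroExt_sub (f g : Bloch n) (z : polydisk n) :
    fderiv ℂ (zeroExt (f - g).fn) z =
      fderiv ℂ (zeroExt f.fn) z - fderiv ℂ (zeroExt g.fn) z := by
  refine (((f.isHol.hasFDerivAt z).sub (g.isHol.hasFDerivAt z)).congr_of_eventuallyEq ?_).fderiv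
  filter_upwards [polydisk_mem_nhds z] with w hw
  have h1 := zeroExt_coe (f - g).fn ⟨w, hw⟩
  have h2 := zeroExt_coe f.fn ⟨w, hw⟩
  have h3 := zeroExt_coe g.fn ⟨w, hw⟩
  dsimp only at h1 h2 h3
  rw [Pi.sub_apply, h1, h2, h3, sub_fn]

/-- The unit ball of the Bloch space is compact for pointwise convergence. -/
theorem Bloch.exists_tendsto_fn (U : Ultrafilter (Bloch n))
    (hU : Metric.closedBall (0 : Bloch n) 1 ∈ U) :
    ∃ f₀ : Bloch n, ‖f₀‖ ≤ 1 ∧ ∀ v, Tendsto (fun f : Bloch n => f.fn v) U (𝓝 (f₀.fn v)) := by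
  have hU1 : ∀ᶠ f in (U : Filter (Bloch n)), ‖f‖ ≤ 1 := by
    filter_upwards [hU] with f hf using mem_closedBall_zero_iff.1 hf
  have hF : ∀ v, ∃ x, Tendsto (fun f : Bloch n => f.fn v) U (𝓝 x) := fun v => by
    refine exists_tendsto_of_eventually_norm_le U
      (C := 1 + ∑ j, -Real.log (1 - ‖v.1 j‖)) (hU1.mono fun f hf => (f.norm_fn_le v).trans ?_)
    refine mul_le_of_le_one_left (add_nonneg zero_le_one (Finset.sum_nonneg fun j _ => ?_)) hf
    exact neg_nonneg.2 (Real.log_nonpos (one_sub_norm_pos v j).le (by simp))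
  choose F hF using hF
  -- Derivatives at a point are bounded in a finite-dimensional space, so they converge along the
  -- ultrafilter too; outside the polydisk `L` is a dummy value.
  have hL : ∀ z : Fin n → ℂ, ∃ L, ‖z‖ < 1 →
      Tendsto (fun f : Bloch n => fderiv ℂ (zeroExt f.fn) z) U (𝓝 L) := fun z => by
    by_cases hz : ‖z‖ < 1
    · have : ProperSpace ((Fin n → ℂ) →L[ℂ] ℂ) := FiniteDimensional.proper ℂ _
      obtain ⟨L, hL⟩ := exists_tendsto_of_eventually_norm_le U
        (hU1.mono fun f hf => (f.norm_fderiv_le le_rfl hz).trans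
          (mul_le_of_le_one_left (div_nonneg n.cast_nonneg
            (by nlinarith [norm_nonneg z])) hf))
      exact ⟨L, fun _ => hL⟩
    · exact ⟨0, fun h => absurd h hz⟩
  choose L hL using hL
  have hderiv : ∀ z : polydisk n, HasFDerivAt (zeroExt F) (L z) z := fun z => by
    have hz := mem_polydisk_iff_norm_lt.1 z.2
    set r : ℝ := (‖z.1‖ + 1) / 2 with hr
    set R : ℝ := (r + 1) / 2 with hR
    have hr1 : r < 1 := by linarith
    have hrR : r < R := by linarith
    have hR1 : R < 1 := by linarith
    have hball : ∀ x ∈ Metric.ball (0 : Fin n → ℂ) r, x ∈ polydisk n := fun x hx =>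
      mem_polydisk_iff_norm_lt.2 ((mem_ball_zero_iff.1 hx).trans hr1)
    have hcauchy : UniformCauchySeqOn (fun f : Bloch n => fderiv ℂ (zeroExt f.fn)) U
        (Metric.ball 0 r) := by
      intro u hu
      obtain ⟨ε, hε, hεu⟩ := Metric.mem_uniformity_dist.1 hu
      -- Cauchy's estimate turns this bound on `‖x‖ ≤ R` into `ε/2` for derivatives on the smaller
      -- ball. It is applied to differences of pairs, a bounded family tending to zero pointwise.
      have hδ : 0 < ε * (R - r) / 4 := div_pos (mul_pos hε (sub_pos.2 hrR)) (by norm_num)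
      have hUU := hU1.prod_mk hU1
      have h := eventually_norm_fn_le (f := fun p : Bloch n × Bloch n => p.1 - p.2) (M := 2)
        (hUU.mono fun p hp => (norm_sub_le _ _).trans (by linarith [hp.1, hp.2]))
        (fun v => by
          simpa [sub_fn] using ((hF v).comp tendsto_fst).sub ((hF v).comp tendsto_snd)) hR1 hδ
      filter_upwards [h] with p hp x hx
      refine hεu ?_
      have hx' := mem_ball_zero_iff.1 hx
      rw [dist_eq_norm, ← fderiv_zeroExt_sub p.1 p.2 ⟨x, hball x hx⟩]
      refine ((p.1 - p.2).isHol.norm_fderiv_le hrR hR1.le hp hx'.le).trans_lt ?_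
      rw [div_lt_iff₀ (sub_pos.2 hrR)]
      nlinarith [mul_pos hε (sub_pos.2 hrR)]
    refine hasFDerivAt_of_tendstoUniformlyOn (l := (U : Filter (Bloch n))) Metric.isOpen_ball
      (hcauchy.tendstoUniformlyOn_of_tendsto (f := L) fun x hx =>
        hL x ((mem_ball_zero_iff.1 hx).trans hr1))
      (fun f x hx => f.isHol.hasFDerivAt ⟨x, hball x hx⟩) (fun x hx => ?_)
      (mem_ball_zero_iff.2 (by linarith : ‖z.1‖ < r))
    have h1 := zeroExt_coe F ⟨x, hball x hx⟩
    dsimp only at h1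
    rw [h1]
    refine (hF ⟨x, hball x hx⟩).congr fun f => ?_
    exact (zeroExt_coe f.fn ⟨x, hball x hx⟩).symm
  have hhol : IsHol F := fun z hz => (hderiv ⟨z, hz⟩).differentiableAt.differentiableWithinAt
  have hF0 : ‖F (polydiskZero n)‖ ≤ 1 :=
    le_of_tendsto (hF _).norm (hU1.mono fun f hf => f.norm_fn_zero_le.trans hf)
  -- The constant `1 - |F(0)|` rather than `1` keeps the limit in the unit ball.
  have hgrad : ∀ z u, ‖gradApply F z u‖ ≤ (1 - ‖F (polydiskZero n)‖) * √(bergmanH z u) :=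
    fun z u => by
      rw [gradApply, (hderiv z).fderiv]
      refine le_of_tendsto_of_tendsto
        ((((ContinuousLinearMap.apply ℂ ℂ u).continuous.tendsto _).comp
          (hL z (mem_polydisk_iff_norm_lt.1 z.2))).norm)
        (((hF (polydiskZero n)).norm.const_sub 1).mul_const _) (hU1.mono fun f hf => ?_)
      refine ((blochBeta_le_ofReal_iff ENNReal.toReal_nonneg).1
        (ENNReal.ofReal_toReal f.beta_lt_top.ne).ge z u).trans ?_
      rw [norm_def] at hf
      refine mul_le_mul_of_nonneg_right ?_ (Real.sqrt_nonneg _)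
      linarith
  refine ⟨ofBound F hhol _ (sub_nonneg.2 hF0) hgrad, ?_, hF⟩
  exact (norm_le (A := ‖F (polydiskZero n)‖) (sub_nonneg.2 hF0) le_rfl hgrad).trans_eq
    (add_sub_cancel _ _)

/-- Under the vanishing conditions at the boundary, the operator maps bounded families which tend
to zero pointwise to families which tend to zero in norm. -/
theorem IsWCO.tendsto_norm_apply_zero_of_tendsto (hn : 1 ≤ n) (hT : IsWCO ψ φ T) (hψ : IsHol ψ)
    (hφ : IsHol (fun z => (φ z : Fin n → ℂ)))
    (hσ : Tendsto (fun z => blochOmega (φ z) * blochQ ψ z) (toBoundary φ) (𝓝 0))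
    (hτ : Tendsto (fun z => ENNReal.ofReal ‖ψ z‖ * blochT φ z) (toBoundary φ) (𝓝 0))
    {ι : Type*} {l : Filter ι} {f : ι → Bloch n} (hM : ∀ᶠ i in l, ‖f i‖ ≤ 2)
    (hf : ∀ v, Tendsto (fun i => (f i).fn v) l (𝓝 0)) :
    Tendsto (fun i => ‖T (f i)‖) l (𝓝 0) := by
  have hψB := hT.mem_blochSubmodule.2
  set B := (blochBeta ψ).toReal with hB
  have hQ : ∀ z, blochQ ψ z ≤ ENNReal.ofReal B := fun z =>
    (blochQ_le_blochBeta ψ z).trans (ENNReal.ofReal_toReal hψB.ne).ge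
  have hB0 : 0 ≤ B := ENNReal.toReal_nonneg
  -- One `ε` is for the value at the origin and five for `β`: near the boundary `δB ≤ ε`, plus `(ε +
  -- ε) · 2` because the norms are at most `2`.
  suffices h : ∀ ε > 0, ∀ᶠ i in l, ‖T (f i)‖ ≤ 6 * ε by
    refine Metric.tendsto_nhds.2 fun ε hε => ?_
    filter_upwards [h (ε / 7) (by positivity)] with i hi
    rw [Real.dist_eq, sub_zero, abs_of_nonneg (norm_nonneg _)]
    linarith
  intro ε hε
  have hε' : 0 < ENNReal.ofReal ε := ENNReal.ofReal_pos.2 hε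
  obtain ⟨r, hr1, hr⟩ := mem_toBoundary_iff.1
    ((hσ.eventually_le_const hε').and (hτ.eventually_le_const hε'))
  set R : ℝ := (r + 1) / 2 with hR
  have hrR : r < R := by linarith
  set D : ℝ := ∑ _j : Fin n, ‖T‖ * 10 with hD
  have hD0 : 0 ≤ D := by positivity
  obtain ⟨δ, hδ, hδB, hδD, hδψ⟩ : ∃ δ > 0, δ * B ≤ ε ∧ 2 * δ / (R - r) * D ≤ ε ∧
      ‖ψ (polydiskZero n)‖ * δ ≤ ε := by
    have h1 : Tendsto (fun δ : ℝ => δ * B) (𝓝[>] 0) (𝓝 0) := by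
      exact tendsto_nhdsWithin_of_tendsto_nhds (Continuous.tendsto' (by fun_prop) _ _ (by simp))
    have h2 : Tendsto (fun δ : ℝ => 2 * δ / (R - r) * D) (𝓝[>] 0) (𝓝 0) := by
      exact tendsto_nhdsWithin_of_tendsto_nhds (Continuous.tendsto' (by fun_prop) _ _ (by simp))
    have h3 : Tendsto (fun δ : ℝ => ‖ψ (polydiskZero n)‖ * δ) (𝓝[>] 0) (𝓝 0) := by
      exact tendsto_nhdsWithin_of_tendsto_nhds (Continuous.tendsto' (by fun_prop) _ _ (by simp))
    obtain ⟨δ, ⟨⟨hb, hd⟩, hp⟩, hδ⟩ := (((h1.eventually_le_const hε).and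
      (h2.eventually_le_const hε)).and (h3.eventually_le_const hε)).and
        self_mem_nhdsWithin |>.exists
    exact ⟨δ, hδ, hb, hd, hp⟩
  have hpt : ∀ v, ∀ᶠ i in l, ‖(f i).fn v‖ ≤ δ := fun v =>
    (tendsto_zero_iff_norm_tendsto_zero.1 (hf v)).eventually_le_const hδ
  filter_upwards [hM, hpt (polydiskZero n), hpt (φ (polydiskZero n)),
    Bloch.eventually_norm_fn_le hM hf (by linarith : R < 1) hδ] with i hi h0 hφ0 hunif
  have hβ : blochBeta (T (f i)).fn ≤ ENNReal.ofReal (5 * ε) := by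
    refine iSup_le fun z => ?_
    rw [hT.fn_eq]
    rcases lt_or_ge r ‖(φ z).1‖ with hz | hz
    · obtain ⟨hz1, hz2⟩ := hr z hz
      refine (blochQ_mul_fn_comp_le hψ hφ (f i) z).trans ?_
      calc _ ≤ ENNReal.ofReal δ * ENNReal.ofReal B +
            (ENNReal.ofReal ε + ENNReal.ofReal ε) * ENNReal.ofReal 2 := by
            gcongr
            exact hQ z
        _ = ENNReal.ofReal (δ * B + (ε + ε) * 2) := by
            rw [ENNReal.ofReal_add (by positivity) (by positivity),
              ENNReal.ofReal_mul (by positivity), ENNReal.ofReal_mul (by positivity),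
              ENNReal.ofReal_add hε.le hε.le]
        _ ≤ _ := ENNReal.ofReal_le_ofReal (by linarith)
    -- Away from the boundary no bound on the derivative of `φ` is available; the extremal functions
    -- at `φ z` and the boundedness of `T` replace it.
    · choose F hF hF0 hd _ using exists_bloch_extremal_deriv hn (φ z)
      refine (blochQ_mul_comp_le hψ (f i).isHol hφ z).trans ?_
      have hM0 : 0 ≤ 2 * δ / (R - r) := div_nonneg (by positivity) (by linarith)
      have h1 := hT.mul_blochQ_comp_le hψ hφ hF0 hd (f i).isHol hM0 fun v => by
        have h2 := (f i).isHol.norm_fderiv_le hrR (by linarith) hunif hz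
        refine (ContinuousLinearMap.le_of_opNorm_le _ h2 v).trans ?_
        have h3 : ∀ j ∈ Finset.univ, 0 ≤ ‖v j‖ / (1 - ‖(φ z).1 j‖ ^ 2) := fun j _ =>
          div_nonneg (norm_nonneg _) (one_sub_norm_sq_pos _ j).le
        refine mul_le_mul_of_nonneg_left
          ((pi_norm_le_iff_of_nonneg (Finset.sum_nonneg h3)).2 fun j => ?_) hM0
        refine le_trans ?_ (Finset.single_le_sum h3 (Finset.mem_univ j))
        refine le_div_self (norm_nonneg _) (one_sub_norm_sq_pos _ j) ?_
        simp
      calc _ ≤ ENNReal.ofReal δ * ENNReal.ofReal B +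
            ENNReal.ofReal (2 * δ / (R - r) * D) := by
            gcongr
            · exact hunif _ (hz.trans hrR.le)
            · exact hQ z
            · refine h1.trans (ENNReal.ofReal_le_ofReal ?_)
              exact mul_le_mul_of_nonneg_left
                (Finset.sum_le_sum fun j _ => T.le_opNorm_of_le (hF j)) hM0
        _ = ENNReal.ofReal (δ * B + 2 * δ / (R - r) * D) := by
            rw [ENNReal.ofReal_add (by positivity) (mul_nonneg hM0 hD0),
              ENNReal.ofReal_mul hδ.le]
        _ ≤ _ := ENNReal.ofReal_le_ofReal (by linarith)
  have h1 := ENNReal.toReal_le_of_le_ofReal (by positivity) hβ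
  have h2 : ‖(T (f i)).fn (polydiskZero n)‖ ≤ ε := by
    rw [hT, norm_mul]
    exact (mul_le_mul_of_nonneg_left hφ0 (norm_nonneg _)).trans hδψ
  rw [Bloch.norm_def]
  linarith

/-- The image of the closed unit ball is itself compact. An ultrafilter on it lifts to the ball,
where it has a pointwise limit `f₀` of norm at most `1`; the differences `f - f₀` have norm at most
`2` and tend to zero pointwise. -/
theorem IsWCO.isCompactOperator (hn : 1 ≤ n) (hT : IsWCO ψ φ T) (hψ : IsHol ψ)
    (hφ : IsHol (fun z => (φ z : Fin n → ℂ)))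
    (hσ : Tendsto (fun z => blochOmega (φ z) * blochQ ψ z) (toBoundary φ) (𝓝 0))
    (hτ : Tendsto (fun z => ENNReal.ofReal ‖ψ z‖ * blochT φ z) (toBoundary φ) (𝓝 0)) :
    IsCompactOperator T := by
  refine ⟨T '' Metric.closedBall 0 1, ?_, mem_of_superset
    (Metric.closedBall_mem_nhds 0 one_pos) (Set.subset_preimage_image T _)⟩
  refine isCompact_iff_ultrafilter_le_nhds'.2 fun U hU => ?_
  set V := Ultrafilter.ofComapInfPrincipal hU with hV
  have hVB : Metric.closedBall (0 : Bloch n) 1 ∈ V := Ultrafilter.ofComapInfPrincipal_mem hU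
  obtain ⟨f₀, hf₀, hlim⟩ := Bloch.exists_tendsto_fn V hVB
  refine ⟨T f₀, ⟨f₀, mem_closedBall_zero_iff.2 hf₀, rfl⟩, ?_⟩
  rw [← Ultrafilter.ofComapInfPrincipal_eq_of_map hU]
  have h := hT.tendsto_norm_apply_zero_of_tendsto hn hψ hφ hσ hτ (l := (V : Filter (Bloch n)))
    (f := fun f => f - f₀) (by
      filter_upwards [hVB] with f hf
      exact (norm_sub_le _ _).trans (by linarith [mem_closedBall_zero_iff.1 hf]))
    (fun v => by simpa [Bloch.sub_fn] using (hlim v).sub_const (f₀.fn v))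
  simp only [map_sub] at h
  exact tendsto_iff_norm_sub_tendsto_zero.2 h

end Sufficiency

end

theorem theorem6p1 (n : ℕ) (hn : 1 ≤ n) (ψ : polydisk n → ℂ) (hψ : IsHol ψ)
    (φ : polydisk n → polydisk n) (hφ : IsHol (fun z => (φ z : Fin n → ℂ))) :
    ((∃ T : Bloch n →L[ℂ] Bloch n, IsWCO ψ φ T) ↔
      ψ ∈ blochSubmodule n ∧ wcoSigma ψ φ < ⊤ ∧ wcoTau ψ φ < ⊤) ∧
    (∀ T : Bloch n →L[ℂ] Bloch n, IsWCO ψ φ T →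
      (IsCompactOperator T ↔
        Tendsto (fun z => blochOmega (φ z) * blochQ ψ z) (toBoundary φ) (𝓝 0) ∧
        Tendsto (fun z => ENNReal.ofReal ‖ψ z‖ * blochT φ z) (toBoundary φ) (𝓝 0))) := by
  refine ⟨⟨?_, fun ⟨h, hσ, hτ⟩ => exists_isWCO h hφ hσ hτ⟩, fun T hT => ⟨fun hc => ?_, ?_⟩⟩
  · rintro ⟨T, hT⟩
    exact ⟨hT.mem_blochSubmodule, hT.wcoSigma_lt_top hn hψ hφ, hT.wcoTau_lt_top hn hψ hφ⟩
  · exact ⟨hT.tendsto_blochOmega_mul hn hc hψ hφ, hT.tendsto_mul_blochT hn hc hψ hφ⟩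
  · rintro ⟨hσ, hτ⟩
    exact hT.isCompactOperator hn hψ hφ hσ hτ
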